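/- Let $\mathcal G=(X,E)$ be a finite graph without loop edges, with conductances $C_{x,y}=C_{y,x}\ge 0$ carried by the edges ($C_{x,y}=0$ if $\{x,y\}$ is not an edge, in particular $C_{x,x}=0$) and a killing measure $\kappa\ge 0$ on $X$. Assume that the energy $\mathcal E(f,f)=\frac12\sum_{x,y}C_{x,y}(f(x)-f(y))^2+\sum_x\kappa_x f(x)^2$ is positive definite. Put $\lambda_x=\sum_y C_{x,y}+\kappa_x$, let $P_{x,y}=C_{x,y}/\lambda_x$ be the transition matrix, and let $G=(\mathrm{diag}(\lambda)-C)^{-1}$ be the Green function. Let $\mu$ be the measure on continuous time loops (modulo shift) defined as follows: a discrete loop with at least two points has mass equal to the product of the transition probabilities of its edges divided by its multiplicity, and its points carry independent exponential holding times of mean $1$; the one point loop at $x$ carries a holding time distributed according to the (infinite) measure $\frac{e^{-t}}{t}\,dt$ on $(0,\infty)$, for each $x\in X$. For $\alpha>0$ let $\mathcal L_\alpha$ be a Poisson process of loops with intensity $\alpha\mu$, let $N^{(\alpha)}_{x,y}$ be the total number of jumps from $x$ to $y$ made by the loops of $\mathcal L_\alpha$, and let $N=N^{(1)}$. Let $\varphi=\varphi_1+i\varphi_2$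 be the complex free field: $\varphi_1,\varphi_2$ are independent centred real Gaussian fields on $X$, each with covariance $G$. Let $Z$ be a Hermitian matrix indexed by $X\times X$ with $0<|Z_{x,y}|\le 1$ for all $x,y$, and let $P^Z$ be the matrix with entries $P_{x,y}Z_{x,y}$. Then the ratio $\det(I-P^Z)/\det(I-P)$ is a positive real number, and: i) for every $\alpha>0$, the numbers $N^{(\alpha)}_{x,y}$ are almost surely finite, $\prod_{x\ne y}Z_{x,y}^{N^{(\alpha)}_{x,y}}$ is integrable, and $$E\Big(\prod_{x\neq y} Z_{x,y}^{N^{(\alpha)}_{x,y}}\Big)=\left[\frac{\det(I-P^{Z})}{\det(I-P)}\right]^{-\alpha};$$ ii) for $\alpha=1$, the variable $\exp\big(\sum_{x\ne y}\frac12 C_{x,y}(Z_{x,y}-1)\varphi_x\bar\varphi_y\big)$ is integrable, and $$E\Big(\prod_{x\neq y} Z_{x,y}^{N_{x,y}}\Big)=E\Big(e^{\sum_{x\neq y}\frac{1}{2} C_{x,y} (Z_{x,y}-1)\varphi_x \bar{\varphi}_y}\Big).$$ (Products and sums over $x\ne y$ run over ordered pairs.) -/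

import Mathlib

open MeasureTheory ProbabilityTheory
open scoped ENNReal NNReal

/-- A graph with symmetric non-negative conductances `C` carried by its edges and a non-negative
killing measure `κ` on its vertices. -/
structure KilledNetwork (X : Type*) where
  graph : SimpleGraph X
  C : X → X → ℝ
  κ : X → ℝ
  C_symm : ∀ x y, C x y = C y x
  C_nonneg : ∀ x y, 0 ≤ C x y
  C_eq_zero_of_not_adj : ∀ x y, ¬ graph.Adj x y → C x y = 0
  κ_nonneg : ∀ x, 0 ≤ κ x

namespace KilledNetwork

variable {X : Type*} [Fintype X] (𝒢 : KilledNetwork X)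

/-- The energy (Dirichlet form) `½ ∑_{x,y} C_{x,y} (f x - f y)² + ∑_x κ_x (f x)²`. -/
noncomputable def energy (f : X → ℝ) : ℝ :=
  (1 / 2) * ∑ x, ∑ y, 𝒢.C x y * (f x - f y) ^ 2 + ∑ x, 𝒢.κ x * f x ^ 2

/-- Transience: the energy form is positive definite. -/
def Transient : Prop := ∀ f : X → ℝ, f ≠ 0 → 0 < 𝒢.energy f

/-- The duality measure `λ_x = ∑_y C_{x,y} + κ_x`. -/
noncomputable def dualityMeasure (x : X) : ℝ := ∑ y, 𝒢.C x y + 𝒢.κ x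

/-- The transition matrix of the Markov chain, `P x y` being the probability of a jump from `x`
to `y`; the missing mass `κ_x / λ_x` is the probability of being killed at `x`. -/
noncomputable def P : Matrix X X ℝ := Matrix.of fun x y => 𝒢.C x y / 𝒢.dualityMeasure x

/-- The Green function of the energy form: the inverse of its matrix `diag(λ) - C`. -/
noncomputable def green [DecidableEq X] : Matrix X X ℝ :=
  (Matrix.diagonal 𝒢.dualityMeasure - Matrix.of 𝒢.C)⁻¹

end KilledNetwork

/-! ### Continuous time loops -/

/-- A discrete pointed loop: `n + 1` vertices, visited in cyclic order (indices in `Fin (n + 1)`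
are added modulo `n + 1`). -/
abbrev DiscretePointedLoop (X : Type*) := Σ n : ℕ, (Fin (n + 1) → X)

/-- A continuous time pointed loop: a discrete pointed loop together with the holding time at each
of its points. The measures used below only charge positive holding times. -/
abbrev PointedLoop (X : Type*) := Σ ξ : DiscretePointedLoop X, (Fin (ξ.1 + 1) → ℝ)

namespace PointedLoop

variable {X : Type*}

/-- The same loop, with its `k`-th point as starting point. -/
def rotate (l : PointedLoop X) (k : Fin (l.1.1 + 1)) : PointedLoop X :=
  ⟨⟨l.1.1, fun i => l.1.2 (i + k)⟩, fun i => l.2 (i + k)⟩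

theorem ext' {n : ℕ} {ξ ξ' : Fin (n + 1) → X} {t t' : Fin (n + 1) → ℝ} (h : ∀ i, ξ i = ξ' i)
    (h' : ∀ i, t i = t' i) : (⟨⟨n, ξ⟩, t⟩ : PointedLoop X) = ⟨⟨n, ξ'⟩, t'⟩ := by
  obtain rfl := funext h
  obtain rfl := funext h'
  rfl

/-- Two pointed loops are equivalent when they differ by a shift of the starting point. -/
def shiftSetoid (X : Type*) : Setoid (PointedLoop X) where
  r l l' := ∃ k, l' = l.rotate k
  iseqv :=
    { refl := by
        rintro ⟨⟨n, ξ⟩, t⟩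
        exact ⟨(0 : Fin (n + 1)), ext' (fun i => by simp) (fun i => by simp)⟩
      symm := by
        rintro ⟨⟨n, ξ⟩, t⟩ _ ⟨k, rfl⟩
        change Fin (n + 1) at k
        exact ⟨(-k : Fin (n + 1)), ext' (fun i => congrArg ξ (neg_add_cancel_right i k).symm)
          fun i => congrArg t (neg_add_cancel_right i k).symm⟩
      trans := by
        rintro ⟨⟨n, ξ⟩, t⟩ _ _ ⟨k, rfl⟩ ⟨k', rfl⟩
        change Fin (n + 1) at k k'
        exact ⟨(k' + k : Fin (n + 1)),
          ext' (fun i => congrArg ξ (add_assoc (i : Fin (n + 1)) k' k))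
            fun i => congrArg t (add_assoc (i : Fin (n + 1)) k' k)⟩ }

/-- The number of jumps from `x` to `y` made by a pointed loop, its last point being followed by
its first one. A one point loop makes no jump. -/
def jumps [DecidableEq X] (x y : X) (l : PointedLoop X) : ℕ :=
  if l.1.1 = 0 then 0
  else (Finset.univ.filter fun i : Fin (l.1.1 + 1) => l.1.2 i = x ∧ l.1.2 (i + 1) = y).card

theorem jumps_rotate [DecidableEq X] (x y : X) (l : PointedLoop X) (k : Fin (l.1.1 + 1)) :
    (l.rotate k).jumps x y = l.jumps x y := by
  obtain ⟨⟨n, ξ⟩, t⟩ := l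
  change Fin (n + 1) at k
  change (if n = 0 then 0 else (Finset.univ.filter fun i : Fin (n + 1) =>
      ξ (i + k) = x ∧ ξ (i + 1 + k) = y).card) = if n = 0 then 0 else
    (Finset.univ.filter fun i : Fin (n + 1) => ξ i = x ∧ ξ (i + 1) = y).card
  by_cases h : n = 0
  · rw [if_pos h, if_pos h]
  · rw [if_neg h, if_neg h]
    refine Finset.card_equiv (Equiv.addRight k) fun i => ?_
    simp [add_right_comm i k 1]

end PointedLoop

/-- A (continuous time) loop: a class of pointed loops modulo shift. It carries the quotient
σ-algebra. -/
abbrev Loop (X : Type*) := Quotient (PointedLoop.shiftSetoid X)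

/-- `N_{x,y}(l)`: the number of jumps from `x` to `y` made by the loop `l`. -/
def Loop.jumps {X : Type*} [DecidableEq X] (x y : X) : Loop X → ℕ :=
  Quotient.lift (PointedLoop.jumps x y) (by
    rintro l _ ⟨k, rfl⟩
    exact (PointedLoop.jumps_rotate x y l k).symm)

namespace KilledNetwork

variable {X : Type*} [Fintype X] (𝒢 : KilledNetwork X)

/-- The law of each holding time of a loop with `n + 1` points: exponential of mean `1` for a
non-trivial loop, and the infinite measure `e^{-t} / t dt` on `t > 0` for a one point loop. -/
noncomputable def holdingMeasure (n : ℕ) : Measure ℝ :=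
  if n = 0 then
    (volume.restrict (Set.Ioi 0)).withDensity fun t => ENNReal.ofReal (Real.exp (-t) / t)
  else expMeasure 1

/-- The mass given to a discrete pointed loop `ξ`: `1` for a one point loop, and otherwise
`P_{ξ₀ξ₁} P_{ξ₁ξ₂} ⋯ P_{ξₙξ₀} / (n + 1)`. As a class modulo shift contains
`(n + 1) / multiplicity` pointed loops, a non-trivial discrete loop receives in total the product
of the transition probabilities of its edges divided by its multiplicity. -/
noncomputable def pointedWeight (ξ : DiscretePointedLoop X) : ℝ≥0∞ :=
  if ξ.1 = 0 then 1
  else ENNReal.ofReal ((∏ i : Fin (ξ.1 + 1), 𝒢.P (ξ.2 i) (ξ.2 (i + 1))) / (ξ.1 + 1))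

/-- The measure on continuous time pointed loops: given the discrete pointed loop, the holding
times are independent. -/
noncomputable def pointedLoopMeasure : Measure (PointedLoop X) :=
  Measure.sum fun ξ : DiscretePointedLoop X =>
    𝒢.pointedWeight ξ • (Measure.pi fun _ : Fin (ξ.1 + 1) => holdingMeasure ξ.1).map (Sigma.mk ξ)

/-- The loop measure `μ`: the image of the pointed loop measure on loops modulo shift. -/
noncomputable def loopMeasure : Measure (Loop X) :=
  𝒢.pointedLoopMeasure.map (Quotient.mk (PointedLoop.shiftSetoid X))

end KilledNetwork

/-- `L` is a Poisson (point) process with intensity `ν`, described by its random counting measure: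
`L ω A` is the number of points in `A`. -/
structure IsPoissonProcess {Ω E : Type*} [MeasurableSpace Ω] [MeasurableSpace E]
    (L : Ω → Measure E) (ν : Measure E) (Pr : Measure Ω) : Prop where
  measurable : Measurable L
  integer_valued : ∀ ω A, MeasurableSet A → ∃ n : ℕ∞, L ω A = (n : ℝ≥0∞)
  poisson : ∀ A, MeasurableSet A → ν A ≠ ∞ →
    Pr.map (fun ω => L ω A) = (poissonMeasure (ν A).toNNReal).map (fun n : ℕ => (n : ℝ≥0∞))
  infinite : ∀ A, MeasurableSet A → ν A = ∞ → ∀ᵐ ω ∂Pr, L ω A = ∞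
  indep : ∀ (n : ℕ) (A : Fin n → Set E), (∀ i, MeasurableSet (A i)) →
    Pairwise (fun i j => Disjoint (A i) (A j)) → iIndepFun (fun i ω => L ω (A i)) Pr

/-- The total number, possibly infinite, of jumps from `x` to `y` made by the loops of a
configuration `L` of loops, given as a counting measure. -/
noncomputable def totalJumps {X : Type*} [DecidableEq X] (L : Measure (Loop X)) (x y : X) : ℝ≥0∞ :=
  ∫⁻ l, (Loop.jumps x y l : ℝ≥0∞) ∂L

/-- The total number of jumps from `x` to `y` as a natural number, when it is finite. -/
noncomputable def jumpNumber {X : Type*} [DecidableEq X] (L : Measure (Loop X)) (x y : X) : ℕ :=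
  ⌊(totalJumps L x y).toReal⌋₊

namespace KilledNetwork

variable {X : Type*} [Fintype X] [DecidableEq X] (𝒢 : KilledNetwork X)

/-- The real free field: the centred Gaussian field with covariance the Green function. -/
structure IsRealFreeField {Ω : Type*} [MeasurableSpace Ω] (φ : X → Ω → ℝ) (Pr : Measure Ω) :
    Prop where
  gaussian : IsGaussianProcess φ Pr
  centred : ∀ x, ∫ ω, φ x ω ∂Pr = 0
  covariance_eq : ∀ x y, covariance (φ x) (φ y) Pr = 𝒢.green x y

/-- The complex free field: its real and imaginary parts are independent real free fields. -/
structure IsComplexFreeField {Ω : Type*} [MeasurableSpace Ω] (φ : X → Ω → ℂ) (Pr : Measure Ω) :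
    Prop where
  re : 𝒢.IsRealFreeField (fun x ω => (φ x ω).re) Pr
  im : 𝒢.IsRealFreeField (fun x ω => (φ x ω).im) Pr
  indep : IndepFun (fun ω x => (φ x ω).re) (fun ω x => (φ x ω).im) Pr

/-- The transition matrix with complex entries. -/
noncomputable def PC : Matrix X X ℂ := Matrix.of fun x y => (𝒢.P x y : ℂ)

/-- The matrix `P^Z` with entries `P_{x,y} Z_{x,y}`. -/
noncomputable def PZ (Z : Matrix X X ℂ) : Matrix X X ℂ :=
  Matrix.of fun x y => (𝒢.P x y : ℂ) * Z x y

end KilledNetwork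

/-!
Write `Λ = diag(λ)`, `C^Z` for the matrix with entries `C_{x,y} Z_{x,y}`, so that
`P^Z = Λ⁻¹ C^Z`, and `N(l)` for the vector of jump numbers of a loop `l`.

Replacing `f` by `|f|` in the energy form shows that `Λ - C^W` is positive definite for every
Hermitian `W` with entries of modulus at most `1` (`Transient.posDef_sub_twistedC`). Apply this to
`W = Z` and `W = -Z`, and diagonalize `C^Z` simultaneously with `Λ`: the eigenvalues of `P^Z` are
real and lie in `(-1, 1)`. Hence `det (1 - P^Z) > 0`, and the logarithm series
`∑ₙ tr ((P^Z)ⁿ) / n` converges to `-log det (1 - P^Z)`. Expanding the traces over closed paths,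
this series is the sum over pointed loops of their weights in the loop measure multiplied by
`∏ Z^N` (`Transient.hasSum_closedPathWeight_mul`); subtracting the same identity for `Z = 1`,
`∫ (∏ Z^{N(l)} - 1) μ(dl) = log det (1 - P) - log det (1 - P^Z)`
(`Transient.hasSum_loopMeasure_mul_sub_one`).

The first identity is then Campbell's formula for the Poisson process of loops
(`IsPoissonProcess.integral_eq_exp_of_hasProd`). Loops are sorted by their vector of jump numbers:
the numbers of loops in the classes with a given non-zero vector are independent Poisson
variables, almost surely only finitely many of them are non-zero, and the one point loops, of
infinite mass, make no jump.

For the second identity, `H = Λ - C` is the inverse of the covariance of the free field, and the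
exponent is half a Hermitian form in `φ̄`, with matrix `Q = C^Z - C`. In a basis orthonormal for
`H` and orthogonal for `Q`, with `Q`-norms `μᵢ`, the real and imaginary parts of the coordinates
of `φ̄` are independent standard Gaussian variables, so the expectation is
`∏ (1 - μᵢ)⁻¹ = det H / det (H - Q)` (`Transient.integral_exp_freeField`). As
`H - Q = Λ - C^Z`, this is `det (1 - P) / det (1 - P^Z)`, the value found in the first identity
for `α = 1`.
-/

/-! ### Simultaneous diagonalization of Hermitian forms -/

namespace Matrix

open scoped ComplexOrder

section Diagonalization

variable {n : Type*} [Fintype n] [DecidableEq n]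

theorem IsHermitian.exists_unitary_diagonal {M : Matrix n n ℂ} (hM : M.IsHermitian) :
    ∃ U : Matrix n n ℂ, Uᴴ * U = 1 ∧
      Uᴴ * M * U = diagonal (fun i => (hM.eigenvalues i : ℂ)) := by
  have hU : (hM.eigenvectorUnitary : Matrix n n ℂ)ᴴ * (hM.eigenvectorUnitary : Matrix n n ℂ) = 1 :=
    Unitary.coe_star_mul_self hM.eigenvectorUnitary
  refine ⟨hM.eigenvectorUnitary, hU, ?_⟩
  have h := hM.spectral_theorem
  rw [Unitary.conjStarAlgAut_apply] at h
  change M = (hM.eigenvectorUnitary : Matrix n n ℂ) * diagonal (RCLike.ofReal ∘ hM.eigenvalues) *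
    (hM.eigenvectorUnitary : Matrix n n ℂ)ᴴ at h
  set U := (hM.eigenvectorUnitary : Matrix n n ℂ)
  calc Uᴴ * M * U = Uᴴ * (U * diagonal (RCLike.ofReal ∘ hM.eigenvalues) * Uᴴ) * U := by rw [← h]
    _ = (Uᴴ * U) * diagonal (RCLike.ofReal ∘ hM.eigenvalues) * (Uᴴ * U) := by
      simp only [Matrix.mul_assoc]
    _ = _ := by rw [hU, Matrix.one_mul, Matrix.mul_one]; rfl

theorem PosDef.exists_conjTranspose_mul_mul_eq_one {H : Matrix n n ℂ} (hH : H.PosDef) :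
    ∃ A : Matrix n n ℂ, Aᴴ * H * A = 1 := by
  obtain ⟨U, -, hU⟩ := hH.isHermitian.exists_unitary_diagonal
  have he := hH.eigenvalues_pos
  set e := hH.isHermitian.eigenvalues
  set s : n → ℂ := fun i => ((√(e i))⁻¹ : ℝ)
  have hs : (diagonal s)ᴴ = diagonal s := by
    rw [diagonal_conjTranspose]; congr 1; ext i; simp [s]
  refine ⟨U * diagonal s, ?_⟩
  calc (U * diagonal s)ᴴ * H * (U * diagonal s)
      = diagonal s * (Uᴴ * H * U) * diagonal s := by
        rw [conjTranspose_mul, hs]; simp only [Matrix.mul_assoc]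
    _ = 1 := by
        rw [hU, diagonal_mul_diagonal, diagonal_mul_diagonal, ← diagonal_one]
        congr 1; ext i
        have h1 : √(e i) ≠ 0 := (Real.sqrt_pos.2 (he i)).ne'
        have h2 : (e i) = √(e i) * √(e i) := (Real.mul_self_sqrt (he i).le).symm
        have h3 : (√(e i))⁻¹ * e i * (√(e i))⁻¹ = 1 := by
          nth_rw 2 [h2]; field_simp
        simp only [s]
        exact_mod_cast h3

/-- A positive definite form and a Hermitian form have a common orthogonal basis, given by the
columns of `A`. -/
theorem PosDef.exists_simultaneous_diagonal {H Q : Matrix n n ℂ} (hH : H.PosDef)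
    (hQ : Q.IsHermitian) :
    ∃ (A : Matrix n n ℂ) (μ : n → ℝ), Aᴴ * H * A = 1 ∧
      Aᴴ * Q * A = diagonal (fun i => (μ i : ℂ)) := by
  obtain ⟨A, hA⟩ := hH.exists_conjTranspose_mul_mul_eq_one
  have hM : (Aᴴ * Q * A).IsHermitian := isHermitian_conjTranspose_mul_mul A hQ
  obtain ⟨U, hU, hUM⟩ := hM.exists_unitary_diagonal
  refine ⟨A * U, hM.eigenvalues, ?_, ?_⟩
  · calc (A * U)ᴴ * H * (A * U) = Uᴴ * (Aᴴ * H * A) * U := by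
          rw [conjTranspose_mul]; simp only [Matrix.mul_assoc]
      _ = 1 := by rw [hA, Matrix.mul_one, hU]
  · rw [← hUM, conjTranspose_mul]; simp only [Matrix.mul_assoc]

theorem mulVec_injective_of_mul_eq_one {A B : Matrix n n ℂ} (h : B * A = 1) :
    Function.Injective A.mulVec := fun v w hvw => by
  simpa [mulVec_mulVec, h] using congrArg B.mulVec hvw

theorem lt_one_of_posDef_sub {H Q A : Matrix n n ℂ} {μ : n → ℝ} (h1 : Aᴴ * H * A = 1)
    (h2 : Aᴴ * Q * A = diagonal (fun i => (μ i : ℂ))) (h : (H - Q).PosDef) (i : n) : μ i < 1 := by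
  have h3 := (h.conjTranspose_mul_mul_same (mulVec_injective_of_mul_eq_one h1)).diag_pos (i := i)
  rw [Matrix.mul_sub, Matrix.sub_mul, h1, h2, sub_apply, one_apply_eq, diagonal_apply_eq] at h3
  have h4 : (0 : ℂ) < ((1 - μ i : ℝ) : ℂ) := by exact_mod_cast h3
  exact sub_pos.1 (Complex.zero_lt_real.1 h4)

theorem neg_one_lt_of_posDef_add {H Q A : Matrix n n ℂ} {μ : n → ℝ} (h1 : Aᴴ * H * A = 1)
    (h2 : Aᴴ * Q * A = diagonal (fun i => (μ i : ℂ))) (h : (H + Q).PosDef) (i : n) :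
    -1 < μ i := by
  have := lt_one_of_posDef_sub (μ := fun i => -μ i) (Q := -Q) h1
    (by rw [Matrix.mul_neg, Matrix.neg_mul, h2, diagonal_neg]; simp)
    (by rwa [sub_neg_eq_add]) i
  linarith

theorem det_sub_eq_of_simultaneous_diagonal {H Q A : Matrix n n ℂ} {μ : n → ℝ}
    (h1 : Aᴴ * H * A = 1) (h2 : Aᴴ * Q * A = diagonal (fun i => (μ i : ℂ))) :
    (H - Q).det = H.det * ((∏ i, (1 - μ i) : ℝ) : ℂ) := by
  have h3 : Aᴴ * (H - Q) * A = diagonal (fun i => ((1 - μ i : ℝ) : ℂ)) := by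
    rw [Matrix.mul_sub, Matrix.sub_mul, h1, h2, ← diagonal_one, diagonal_sub]; simp
  have d1 := congrArg det h1
  have d3 := congrArg det h3
  rw [det_mul, det_mul, det_one] at d1
  rw [det_mul, det_mul, det_diagonal] at d3
  push_cast at d3 ⊢
  rw [← d3]
  linear_combination (-(H - Q).det) * d1

theorem trace_inv_mul_pow_eq_of_simultaneous_diagonal {H Q A : Matrix n n ℂ} {μ : n → ℝ}
    (h1 : Aᴴ * H * A = 1) (h2 : Aᴴ * Q * A = diagonal (fun i => (μ i : ℂ))) (k : ℕ) :
    ((H⁻¹ * Q) ^ k).trace = ((∑ i, μ i ^ k : ℝ) : ℂ) := by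
  have hA : A * (Aᴴ * H) = 1 := mul_eq_one_comm.1 h1
  have hH : H⁻¹ = A * Aᴴ := inv_eq_left_inv (by rw [Matrix.mul_assoc, hA])
  have h3 : H⁻¹ * Q = A * diagonal (fun i => (μ i : ℂ)) * (Aᴴ * H) := by
    rw [← h2, hH]
    calc A * Aᴴ * Q = A * Aᴴ * Q * (A * (Aᴴ * H)) := by rw [hA, Matrix.mul_one]
      _ = _ := by simp only [Matrix.mul_assoc]
  have h4 : (H⁻¹ * Q) ^ k = A * diagonal (fun i => (μ i : ℂ)) ^ k * (Aᴴ * H) := by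
    induction k with
    | zero => simp [hA]
    | succ k ih =>
      rw [pow_succ, ih, h3]
      calc A * diagonal (fun i => (μ i : ℂ)) ^ k * (Aᴴ * H) *
            (A * diagonal (fun i => (μ i : ℂ)) * (Aᴴ * H))
          = A * diagonal (fun i => (μ i : ℂ)) ^ k * (Aᴴ * H * A) *
            diagonal (fun i => (μ i : ℂ)) * (Aᴴ * H) := by simp only [Matrix.mul_assoc]
        _ = _ := by rw [h1, Matrix.mul_one, pow_succ]; simp only [Matrix.mul_assoc]
  rw [h4, Matrix.trace_mul_comm, ← Matrix.mul_assoc, h1, Matrix.one_mul, diagonal_pow,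
    trace_diagonal]
  push_cast
  rfl

end Diagonalization

/-! ### Traces of powers as sums over closed paths -/

section ClosedPaths

variable {X R : Type*} [Fintype X] [DecidableEq X] [CommSemiring R]

/-- The path from `x` to `y` through the inner points `ξ` has `cons x ξ` as the starting points of
its steps and `snoc ξ y` as their end points. -/
theorem pow_succ_apply_eq_sum_paths (M : Matrix X X R) (n : ℕ) (x y : X) :
    (M ^ (n + 1)) x y = ∑ ξ : Fin n → X, ∏ i : Fin (n + 1),
      M (Fin.cons (α := fun _ => X) x ξ i) (Fin.snoc (α := fun _ => X) ξ y i) := by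
  induction n generalizing x with
  | zero => simp [Fin.snoc]
  | succ n ih =>
    rw [pow_succ', mul_apply, ← (Fin.consEquiv fun _ : Fin (n + 1) => X).sum_comp,
      Fintype.sum_prod_type]
    refine Finset.sum_congr rfl fun z _ => ?_
    rw [ih, Finset.mul_sum]
    refine Finset.sum_congr rfl fun ξ _ => ?_
    have h : Fin.snoc (α := fun _ => X) (Fin.cons (α := fun _ => X) z ξ) y =
        Fin.cons (α := fun _ => X) z (Fin.snoc (α := fun _ => X) ξ y) :=
      (Fin.cons_snoc_eq_snoc_cons z ξ y).symm
    rw [Fin.prod_univ_succ (n := n + 1)]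
    simp only [Fin.consEquiv, Equiv.coe_fn_mk, Fin.cons_zero, Fin.cons_succ]
    rw [h]
    simp only [Fin.cons_zero, Fin.cons_succ]

theorem trace_pow_succ_eq_sum_closed_paths (M : Matrix X X R) (n : ℕ) :
    (M ^ (n + 1)).trace = ∑ ξ : Fin (n + 1) → X, ∏ i, M (ξ i) (ξ (i + 1)) := by
  rw [← (Fin.consEquiv fun _ : Fin (n + 1) => X).sum_comp, Fintype.sum_prod_type]
  refine Finset.sum_congr rfl fun x _ => ?_
  rw [diag_apply, pow_succ_apply_eq_sum_paths]
  refine Finset.sum_congr rfl fun ξ _ => Finset.prod_congr rfl fun i _ => ?_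
  simp only [Fin.consEquiv, Equiv.coe_fn_mk]
  congr 1
  refine Fin.lastCases ?_ (fun j => ?_) i
  · simp
  · simp

end ClosedPaths

end Matrix

/-! ### Positivity of the energy form with a Hermitian twist -/

namespace KilledNetwork

open scoped ComplexOrder

theorem C_self {X : Type*} (𝒢 : KilledNetwork X) (x : X) : 𝒢.C x x = 0 :=
  𝒢.C_eq_zero_of_not_adj x x (𝒢.graph.loopless.irrefl x)

/-- The matrix of conductances twisted by `W`, with entries `C_{x,y} W_{x,y}`. -/
noncomputable def twistedC {X : Type*} (𝒢 : KilledNetwork X) (W : Matrix X X ℂ) : Matrix X X ℂ :=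
  Matrix.of fun x y => (𝒢.C x y : ℂ) * W x y

theorem isHermitian_twistedC {X : Type*} (𝒢 : KilledNetwork X) {W : Matrix X X ℂ}
    (hW : W.IsHermitian) : (𝒢.twistedC W).IsHermitian := by
  ext x y
  simp [twistedC, ← hW.apply x y, 𝒢.C_symm y x]

variable {X : Type*} [Fintype X] (𝒢 : KilledNetwork X)

theorem energy_eq (f : X → ℝ) :
    𝒢.energy f = ∑ x, 𝒢.dualityMeasure x * f x ^ 2 - ∑ x, ∑ y, 𝒢.C x y * (f x * f y) := by
  have h1 : ∑ x, ∑ y, 𝒢.C x y * f y ^ 2 = ∑ x, ∑ y, 𝒢.C x y * f x ^ 2 := by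
    rw [Finset.sum_comm]
    exact Finset.sum_congr rfl fun x _ => Finset.sum_congr rfl fun y _ => by rw [𝒢.C_symm]
  have h2 : ∑ x, ∑ y, 𝒢.C x y * (f x - f y) ^ 2 = ∑ x, ∑ y, 𝒢.C x y * f x ^ 2 +
      ∑ x, ∑ y, 𝒢.C x y * f y ^ 2 - 2 * ∑ x, ∑ y, 𝒢.C x y * (f x * f y) := by
    simp only [Finset.mul_sum, ← Finset.sum_add_distrib, ← Finset.sum_sub_distrib]
    exact Finset.sum_congr rfl fun x _ => Finset.sum_congr rfl fun y _ => by ring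
  have h3 : ∑ x, 𝒢.dualityMeasure x * f x ^ 2 =
      ∑ x, ∑ y, 𝒢.C x y * f x ^ 2 + ∑ x, 𝒢.κ x * f x ^ 2 := by
    simp only [dualityMeasure, add_mul, Finset.sum_add_distrib, Finset.sum_mul]
  rw [energy, h2, h3, h1]
  ring

variable {𝒢}

theorem Transient.dualityMeasure_pos [DecidableEq X] (h : 𝒢.Transient) (x : X) :
    0 < 𝒢.dualityMeasure x := by
  -- the energy of the indicator of `x` is `λ x`, there being no loop edges
  have h1 := h (Pi.single x 1) (by simp)
  rw [energy_eq] at h1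
  simpa [Pi.single_apply, 𝒢.C_self] using h1

variable (𝒢)

/-- The matrix `diag(λ)` with complex entries. -/
noncomputable def dualityMatrix [DecidableEq X] : Matrix X X ℂ :=
  Matrix.diagonal fun x => (𝒢.dualityMeasure x : ℂ)

variable {𝒢}

/-- The twisted energy of `f` is bounded below by the energy of `|f|`: this is where
`|W x y| ≤ 1` enters. -/
theorem Transient.posDef_sub_twistedC [DecidableEq X] (h : 𝒢.Transient) {W : Matrix X X ℂ}
    (hW : W.IsHermitian) (hW1 : ∀ x y, ‖W x y‖ ≤ 1) :
    (𝒢.dualityMatrix - 𝒢.twistedC W).PosDef := by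
  have hH : (𝒢.dualityMatrix - 𝒢.twistedC W).IsHermitian :=
    (Matrix.isHermitian_diagonal_of_self_adjoint _ (by ext; simp)).sub (𝒢.isHermitian_twistedC hW)
  refine .of_dotProduct_mulVec_pos hH fun f hf => ?_
  have him := hH.im_star_dotProduct_mulVec_self f
  rw [Complex.pos_iff]
  refine ⟨?_, him.symm⟩
  have h1 := h (fun x => ‖f x‖) (fun h0 => hf (funext fun x => by simpa using congrFun h0 x))
  rw [energy_eq] at h1
  have h2 : star f ⬝ᵥ (𝒢.dualityMatrix - 𝒢.twistedC W).mulVec f =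
      ((∑ x, 𝒢.dualityMeasure x * ‖f x‖ ^ 2 : ℝ) : ℂ) -
        ∑ x, ∑ y, (𝒢.C x y : ℂ) * W x y * (star (f x) * f y) := by
    rw [Matrix.sub_mulVec, dotProduct_sub]
    congr 1
    · simp only [dualityMatrix, dotProduct, Matrix.mulVec_diagonal]
      push_cast
      refine Finset.sum_congr rfl fun x _ => ?_
      rw [← Complex.conj_mul']
      simp only [Pi.star_apply, RCLike.star_def]
      ring
    · simp only [dotProduct, Matrix.mulVec, Finset.mul_sum, twistedC, Matrix.of_apply,
        Pi.star_apply]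
      exact Finset.sum_congr rfl fun x _ => Finset.sum_congr rfl fun y _ => by ring
  rw [h2, Complex.sub_re, Complex.ofReal_re]
  refine h1.trans_le (sub_le_sub_left ?_ _)
  refine (Complex.re_le_norm _).trans ((norm_sum_le _ _).trans (Finset.sum_le_sum fun x _ =>
    (norm_sum_le _ _).trans (Finset.sum_le_sum fun y _ => ?_)))
  rw [norm_mul, norm_mul, norm_mul, norm_star, Complex.norm_of_nonneg (𝒢.C_nonneg x y)]
  refine mul_le_mul_of_nonneg_right ?_ (by positivity)
  exact mul_le_of_le_one_right (𝒢.C_nonneg x y) (hW1 x y)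

end KilledNetwork

/-! ### Weights of discrete loops and the logarithm of the determinant -/

namespace KilledNetwork

open scoped ComplexOrder

theorem isHermitian_of_one {X : Type*} : (Matrix.of fun _ _ : X => (1 : ℂ)).IsHermitian := by
  ext; simp

variable {X : Type*} [Fintype X]

theorem PZ_one (𝒢 : KilledNetwork X) : 𝒢.PZ (Matrix.of fun _ _ => 1) = 𝒢.PC := by
  ext; simp [PZ, PC]

theorem P_nonneg (𝒢 : KilledNetwork X) (x y : X) : 0 ≤ 𝒢.P x y :=
  div_nonneg (𝒢.C_nonneg x y)
    (add_nonneg (Finset.sum_nonneg fun _ _ => 𝒢.C_nonneg _ _) (𝒢.κ_nonneg x))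

theorem P_self (𝒢 : KilledNetwork X) (x : X) : 𝒢.P x x = 0 := by simp [P, 𝒢.C_self]

/-- The weight `P_{ξ₀ξ₁} ⋯ P_{ξₙξ₀} / (n + 1)` of a pointed loop; it vanishes on one point
loops. -/
noncomputable def closedPathWeight (𝒢 : KilledNetwork X) (ξ : DiscretePointedLoop X) : ℝ :=
  (∏ i : Fin (ξ.1 + 1), 𝒢.P (ξ.2 i) (ξ.2 (i + 1))) / (ξ.1 + 1)

theorem closedPathWeight_nonneg (𝒢 : KilledNetwork X) (ξ : DiscretePointedLoop X) :
    0 ≤ 𝒢.closedPathWeight ξ :=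
  div_nonneg (Finset.prod_nonneg fun _ _ => 𝒢.P_nonneg _ _) (by positivity)

theorem closedPathWeight_eq_zero (𝒢 : KilledNetwork X) {ξ : DiscretePointedLoop X}
    {i : Fin (ξ.1 + 1)} (h : ξ.2 i = ξ.2 (i + 1)) : 𝒢.closedPathWeight ξ = 0 := by
  rw [closedPathWeight, Finset.prod_eq_zero (Finset.mem_univ i), zero_div]
  rw [← h, P_self]

theorem closedPathWeight_eq_zero_of_length (𝒢 : KilledNetwork X) {ξ : DiscretePointedLoop X}
    (h : ξ.1 = 0) : 𝒢.closedPathWeight ξ = 0 := by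
  obtain ⟨n, ξ⟩ := ξ
  obtain rfl : n = 0 := h
  exact 𝒢.closedPathWeight_eq_zero (i := (0 : Fin 1))
    (congrArg ξ (Subsingleton.elim (α := Fin 1) _ _))

variable [DecidableEq X] {𝒢 : KilledNetwork X}

theorem Transient.posDef_dualityMatrix (h : 𝒢.Transient) : 𝒢.dualityMatrix.PosDef :=
  .diagonal fun x => Complex.zero_lt_real.2 (h.dualityMeasure_pos x)

theorem Transient.PZ_eq_inv_mul (h : 𝒢.Transient) (W : Matrix X X ℂ) :
    𝒢.PZ W = 𝒢.dualityMatrix⁻¹ * 𝒢.twistedC W := by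
  have h1 : 𝒢.dualityMatrix⁻¹ = Matrix.diagonal fun x => ((𝒢.dualityMeasure x)⁻¹ : ℂ) := by
    refine Matrix.inv_eq_left_inv ?_
    rw [dualityMatrix, Matrix.diagonal_mul_diagonal, ← Matrix.diagonal_one]
    congr 1; ext x
    exact inv_mul_cancel₀ (Complex.ofReal_ne_zero.2 (h.dualityMeasure_pos x).ne')
  ext x y
  rw [h1, Matrix.diagonal_mul]
  simp only [PZ, P, twistedC, Matrix.of_apply]
  push_cast
  ring

theorem Transient.det_one_sub_PZ (h : 𝒢.Transient) (W : Matrix X X ℂ) :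
    (1 - 𝒢.PZ W).det = 𝒢.dualityMatrix.det⁻¹ * (𝒢.dualityMatrix - 𝒢.twistedC W).det := by
  have hdet : IsUnit 𝒢.dualityMatrix.det :=
    (Matrix.isUnit_iff_isUnit_det _).1 h.posDef_dualityMatrix.isUnit
  have h1 : 1 - 𝒢.PZ W = 𝒢.dualityMatrix⁻¹ * (𝒢.dualityMatrix - 𝒢.twistedC W) := by
    rw [Matrix.mul_sub, Matrix.nonsing_inv_mul _ hdet, h.PZ_eq_inv_mul]
  rw [h1, Matrix.det_mul, Matrix.det_nonsing_inv, Ring.inverse_eq_inv']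

/-- The eigenvalues `μ` of `P^W` are those of a Hermitian form relative to `diag(λ)`. Both
`diag(λ) - C^W` and `diag(λ) + C^W` being positive definite, `|μ| < 1`, so the logarithm series of
`det (1 - P^W) = ∏ (1 - μ)` converges. -/
theorem Transient.exists_det_one_sub_PZ (h : 𝒢.Transient) {W : Matrix X X ℂ}
    (hW : W.IsHermitian) (hW1 : ∀ x y, ‖W x y‖ ≤ 1) :
    ∃ d : ℝ, 0 < d ∧ (1 - 𝒢.PZ W).det = d ∧
      HasSum (fun n : ℕ => (𝒢.PZ W ^ (n + 1)).trace / (n + 1)) (-Real.log d : ℂ) := by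
  have hΛ := h.posDef_dualityMatrix
  obtain ⟨A, μ, h1, h2⟩ := hΛ.exists_simultaneous_diagonal (𝒢.isHermitian_twistedC hW)
  have hlt := Matrix.lt_one_of_posDef_sub h1 h2 (h.posDef_sub_twistedC hW hW1)
  have hneg : 𝒢.twistedC (-W) = -𝒢.twistedC W := by ext; simp [twistedC]
  have hgt := Matrix.neg_one_lt_of_posDef_add h1 h2 (by
    have := h.posDef_sub_twistedC hW.neg (by simpa using hW1)
    rwa [hneg, sub_neg_eq_add] at this)
  have hpos : ∀ i, 0 < 1 - μ i := fun i => sub_pos.2 (hlt i)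
  refine ⟨∏ i, (1 - μ i), Finset.prod_pos fun i _ => hpos i, ?_, ?_⟩
  · rw [h.det_one_sub_PZ, Matrix.det_sub_eq_of_simultaneous_diagonal h1 h2,
      inv_mul_cancel_left₀ hΛ.det_pos.ne']
  · have h3 : HasSum (fun n : ℕ => ∑ i, μ i ^ (n + 1) / (n + 1)) (∑ i, -Real.log (1 - μ i)) :=
      hasSum_sum fun i _ =>
        Real.hasSum_pow_div_log_of_abs_lt_one (abs_lt.2 ⟨hgt i, hlt i⟩)
    rw [Real.log_prod fun i _ => (hpos i).ne', ← Complex.ofReal_neg, ← Finset.sum_neg_distrib]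
    refine (Complex.hasSum_ofReal.2 h3).congr_fun ?_
    intro n
    rw [h.PZ_eq_inv_mul, Matrix.trace_inv_mul_pow_eq_of_simultaneous_diagonal h1 h2]
    push_cast
    rw [Finset.sum_div]

theorem sum_closedPathWeight_mul (W : Matrix X X ℂ) (n : ℕ) :
    ∑ ξ : Fin (n + 1) → X, (𝒢.closedPathWeight ⟨n, ξ⟩ : ℂ) * ∏ i, W (ξ i) (ξ (i + 1)) =
      (𝒢.PZ W ^ (n + 1)).trace / (n + 1) := by
  rw [Matrix.trace_pow_succ_eq_sum_closed_paths, Finset.sum_div]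
  refine Finset.sum_congr rfl fun ξ _ => ?_
  simp only [closedPathWeight, PZ, Matrix.of_apply, Finset.prod_mul_distrib]
  push_cast
  ring

theorem Transient.summable_closedPathWeight (h : 𝒢.Transient) : Summable 𝒢.closedPathWeight := by
  obtain ⟨d, -, -, hd⟩ := h.exists_det_one_sub_PZ isHermitian_of_one (by simp)
  refine (summable_sigma_of_nonneg 𝒢.closedPathWeight_nonneg).2
    ⟨fun n => (hasSum_fintype _).summable, ?_⟩
  refine Complex.summable_ofReal.1 (hd.summable.congr fun n => ?_)
  rw [← sum_closedPathWeight_mul, tsum_fintype]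
  simp

/-- The generating function of the loop measure: the sum over loops of their twisted weights is
`-log det (1 - P^W)`. -/
theorem Transient.hasSum_closedPathWeight_mul (h : 𝒢.Transient) {W : Matrix X X ℂ}
    (hW : W.IsHermitian) (hW1 : ∀ x y, ‖W x y‖ ≤ 1) :
    ∃ d : ℝ, 0 < d ∧ (1 - 𝒢.PZ W).det = d ∧
      HasSum (fun ξ : DiscretePointedLoop X =>
        (𝒢.closedPathWeight ξ : ℂ) * ∏ i, W (ξ.2 i) (ξ.2 (i + 1))) (-Real.log d : ℂ) := by
  obtain ⟨d, hd0, hd1, hd⟩ := h.exists_det_one_sub_PZ hW hW1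
  refine ⟨d, hd0, hd1, ?_⟩
  have hs : Summable (fun ξ : DiscretePointedLoop X =>
      (𝒢.closedPathWeight ξ : ℂ) * ∏ i, W (ξ.2 i) (ξ.2 (i + 1))) := by
    refine h.summable_closedPathWeight.of_norm_bounded fun ξ => ?_
    rw [norm_mul, Complex.norm_of_nonneg (𝒢.closedPathWeight_nonneg ξ), norm_prod]
    exact mul_le_of_le_one_right (𝒢.closedPathWeight_nonneg ξ)
      (Finset.prod_le_one (fun _ _ => norm_nonneg _) fun _ _ => hW1 _ _)
  have h1 := hs.hasSum.sigma fun n => hasSum_fintype _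
  simp only [sum_closedPathWeight_mul] at h1
  rw [← h1.unique hd]
  exact hs.hasSum

end KilledNetwork

/-- The numbers of jumps of a discrete pointed loop between each pair of vertices. -/
def DiscretePointedLoop.jumps {X : Type*} [DecidableEq X] (ξ : DiscretePointedLoop X) (x y : X) :
    ℕ :=
  PointedLoop.jumps x y ⟨ξ, 0⟩

theorem DiscretePointedLoop.jumps_eq_zero {X : Type*} [DecidableEq X] {ξ : DiscretePointedLoop X}
    (h : ξ.1 = 0) : ξ.jumps = 0 := by
  ext x y
  simp [DiscretePointedLoop.jumps, PointedLoop.jumps, h]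

/-- A step `ξᵢ = ξᵢ₊₁` would contribute a diagonal entry of `W` on the right only, but it makes the
weight vanish since `P x x = 0`. -/
theorem KilledNetwork.closedPathWeight_mul_prod_pow_jumps {X : Type*} [Fintype X] [DecidableEq X]
    (𝒢 : KilledNetwork X) (W : Matrix X X ℂ) (ξ : DiscretePointedLoop X) :
    (𝒢.closedPathWeight ξ : ℂ) * ∏ p ∈ Finset.univ.offDiag, W p.1 p.2 ^ ξ.jumps p.1 p.2 =
      (𝒢.closedPathWeight ξ : ℂ) * ∏ i, W (ξ.2 i) (ξ.2 (i + 1)) := by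
  by_cases h0 : ξ.1 = 0
  · simp [𝒢.closedPathWeight_eq_zero_of_length h0]
  by_cases h : ∃ i, ξ.2 i = ξ.2 (i + 1)
  · obtain ⟨i, hi⟩ := h
    simp [𝒢.closedPathWeight_eq_zero hi]
  push Not at h
  congr 1
  rw [← Finset.prod_fiberwise_of_maps_to (s := Finset.univ) (t := Finset.univ.offDiag)
    (g := fun i => (ξ.2 i, ξ.2 (i + 1))) (fun i _ => by simpa using h i)]
  refine Finset.prod_congr rfl fun p _ => ?_
  rw [Finset.prod_congr rfl (g := fun _ => W p.1 p.2), Finset.prod_const]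
  · simp [DiscretePointedLoop.jumps, PointedLoop.jumps, h0, Prod.ext_iff]
  · intro i hi
    rw [← (Finset.mem_filter.1 hi).2]

/-! ### The loop measure of a given vector of jump numbers -/

theorem measurableSet_sigma_iff {ι : Type*} {β : ι → Type*} [∀ i, MeasurableSpace (β i)]
    {s : Set (Sigma β)} : MeasurableSet s ↔ ∀ i, MeasurableSet (Sigma.mk i ⁻¹' s) :=
  MeasurableSpace.measurableSet_iInf

theorem measurable_sigma_mk {ι : Type*} {β : ι → Type*} [∀ i, MeasurableSpace (β i)] (i : ι) :
    Measurable (Sigma.mk i : β i → Sigma β) := fun _ hs => measurableSet_sigma_iff.1 hs i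

theorem PointedLoop.measurable_jumps {X : Type*} [DecidableEq X] (x y : X) :
    Measurable (PointedLoop.jumps x y : PointedLoop X → ℕ) := fun s _ => by
  refine measurableSet_sigma_iff.2 fun ξ => ?_
  exact MeasurableSet.const (ξ.jumps x y ∈ s)

/-- The numbers of jumps of a loop between each pair of vertices, as a vector. -/
def Loop.jumpVector {X : Type*} [DecidableEq X] (l : Loop X) : X → X → ℕ :=
  fun x y => Loop.jumps x y l

theorem Loop.measurable_jumpVector {X : Type*} [DecidableEq X] :
    Measurable (Loop.jumpVector : Loop X → X → X → ℕ) :=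
  measurable_pi_iff.2 fun x => measurable_pi_iff.2 fun y => fun _ hs =>
    PointedLoop.measurable_jumps x y hs

theorem isProbabilityMeasure_holdingMeasure {n : ℕ} (hn : n ≠ 0) :
    IsProbabilityMeasure (KilledNetwork.holdingMeasure n) := by
  rw [KilledNetwork.holdingMeasure, if_neg hn]
  exact isProbabilityMeasure_expMeasure one_pos

namespace KilledNetwork

variable {X : Type*} [Fintype X] [DecidableEq X] (𝒢 : KilledNetwork X)

/-- The holding times do not influence the numbers of jumps, and the one point loops, which carry
an infinite mass, make no jump. -/
theorem loopMeasure_jumpVector_preimage {k : X → X → ℕ} (hk : k ≠ 0) :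
    𝒢.loopMeasure (Loop.jumpVector ⁻¹' {k}) =
      ∑' ξ : (DiscretePointedLoop.jumps ⁻¹' {k} : Set (DiscretePointedLoop X)),
        ENNReal.ofReal (𝒢.closedPathWeight ξ) := by
  have hB : MeasurableSet (Loop.jumpVector ⁻¹' {k} : Set (Loop X)) :=
    Loop.measurable_jumpVector (measurableSet_singleton k)
  rw [loopMeasure, Measure.map_apply measurable_quotient_mk'' hB, pointedLoopMeasure,
    Measure.sum_apply _ (measurable_quotient_mk'' hB),
    tsum_subtype (DiscretePointedLoop.jumps ⁻¹' {k}) fun ξ => ENNReal.ofReal (𝒢.closedPathWeight ξ)]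
  refine tsum_congr fun ξ => ?_
  rw [Measure.smul_apply, Measure.map_apply (measurable_sigma_mk ξ) (measurable_quotient_mk'' hB)]
  by_cases hξ : ξ.jumps = k
  · have h0 : ξ.1 ≠ 0 := fun h0 => hk (by rw [← hξ, DiscretePointedLoop.jumps_eq_zero h0])
    have hu : Sigma.mk ξ ⁻¹' ((Quotient.mk'' : PointedLoop X → Loop X) ⁻¹'
        (Loop.jumpVector ⁻¹' {k})) = Set.univ := Set.eq_univ_of_forall fun t => hξ
    have := isProbabilityMeasure_holdingMeasure h0
    rw [Set.indicator_of_mem (show ξ ∈ DiscretePointedLoop.jumps ⁻¹' {k} from hξ)]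
    erw [hu]
    rw [measure_univ, pointedWeight, if_neg h0, smul_eq_mul, mul_one, closedPathWeight]
  · have hu : Sigma.mk ξ ⁻¹' ((Quotient.mk'' : PointedLoop X → Loop X) ⁻¹'
        (Loop.jumpVector ⁻¹' {k})) = ∅ := Set.eq_empty_of_forall_notMem fun t => hξ
    rw [Set.indicator_of_notMem (show ξ ∉ DiscretePointedLoop.jumps ⁻¹' {k} from hξ)]
    erw [hu]
    rw [measure_empty, smul_zero]

end KilledNetwork

/-! ### Generating functions of Poisson processes -/

theorem ProbabilityTheory.integral_pow_poissonMeasure (r : ℝ≥0) (z : ℂ) :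
    ∫ n, z ^ n ∂poissonMeasure r = Complex.exp (r * (z - 1)) := by
  rw [integral_poissonMeasure]
  calc ∑' n : ℕ, (Real.exp (-r) * r ^ n / n.factorial) • z ^ n
      = ∑' n : ℕ, (Real.exp (-r) : ℂ) * ((r * z) ^ n / n.factorial) := by
        refine tsum_congr fun n => ?_
        rw [Complex.real_smul]
        push_cast
        ring
    _ = Complex.exp (r * (z - 1)) := by
        rw [tsum_mul_left, (NormedSpace.expSeries_div_hasSum_exp (r * z : ℂ)).tsum_eq,
          ← Complex.exp_eq_exp_ℂ, Complex.ofReal_exp, ← Complex.exp_add]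
        push_cast
        ring_nf

namespace IsPoissonProcess

variable {Ω E : Type*} [MeasurableSpace Ω] [MeasurableSpace E] {L : Ω → Measure E}
  {ν : Measure E} {Pr : Measure Ω}

theorem measurable_apply (hL : IsPoissonProcess L ν Pr) {A : Set E} (hA : MeasurableSet A) :
    Measurable fun ω => L ω A :=
  (Measure.measurable_coe hA).comp hL.measurable

theorem measurable_floor_apply (hL : IsPoissonProcess L ν Pr) {A : Set E}
    (hA : MeasurableSet A) : Measurable fun ω => ⌊(L ω A).toReal⌋₊ :=
  Nat.measurable_floor.comp (hL.measurable_apply hA).ennreal_toReal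

theorem ae_ne_top (hL : IsPoissonProcess L ν Pr) {A : Set E} (hA : MeasurableSet A)
    (hν : ν A ≠ ∞) : ∀ᵐ ω ∂Pr, L ω A ≠ ∞ := by
  have h : ∀ᵐ a ∂Pr.map (fun ω => L ω A), a ≠ ∞ := by
    rw [hL.poisson A hA hν]
    refine (ae_map_iff (by fun_prop) (measurableSet_singleton _).compl).2 (ae_of_all _ fun n => ?_)
    exact ENNReal.natCast_ne_top n
  exact (ae_map_iff (hL.measurable_apply hA).aemeasurable (measurableSet_singleton _).compl).1 h

theorem integral_pow_apply (hL : IsPoissonProcess L ν Pr) {A : Set E} (hA : MeasurableSet A)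
    (hν : ν A ≠ ∞) (z : ℂ) :
    ∫ ω, z ^ ⌊(L ω A).toReal⌋₊ ∂Pr = Complex.exp ((ν A).toReal * (z - 1)) := by
  have hm : Measurable fun a : ℝ≥0∞ => z ^ ⌊a.toReal⌋₊ :=
    (measurable_of_countable fun n : ℕ => z ^ n).comp
      (Nat.measurable_floor.comp ENNReal.measurable_toReal)
  rw [← integral_map (φ := fun ω => L ω A) (f := fun a : ℝ≥0∞ => z ^ ⌊a.toReal⌋₊)
    (hL.measurable_apply hA).aemeasurable hm.aestronglyMeasurable, hL.poisson A hA hν,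
    integral_map (by fun_prop) hm.aestronglyMeasurable]
  simp only [ENNReal.toReal_natCast, Nat.floor_natCast]
  exact integral_pow_poissonMeasure _ z

variable {ι : Type*} {B : ι → Set E} {z : ι → ℂ}

theorem integral_finset_prod_pow (hL : IsPoissonProcess L ν Pr) (s : Finset ι)
    (hB : ∀ i, MeasurableSet (B i)) (hd : Pairwise fun i j => Disjoint (B i) (B j))
    (hν : ∀ i, ν (B i) ≠ ∞) :
    ∫ ω, ∏ i ∈ s, z i ^ ⌊(L ω (B i)).toReal⌋₊ ∂Pr =
      Complex.exp (∑ i ∈ s, (ν (B i)).toReal * (z i - 1)) := by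
  have e := s.equivFin.symm
  have hi := hL.indep s.card (fun j => B (e j)) (fun j => hB _) fun j j' hj =>
    hd fun h => hj (e.injective (Subtype.ext h))
  have hm : ∀ w : ℂ, Measurable fun a : ℝ≥0∞ => w ^ ⌊a.toReal⌋₊ := fun w =>
    (measurable_of_countable fun n : ℕ => w ^ n).comp
      (Nat.measurable_floor.comp ENNReal.measurable_toReal)
  have h1 := hi.integral_fun_prod_comp (f := fun j a => z (e j) ^ ⌊a.toReal⌋₊)
    (fun j => (hL.measurable_apply (hB _)).aemeasurable)
    fun j => (hm (z (e j))).aestronglyMeasurable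
  have h2 : ∀ ω, ∏ i ∈ s, z i ^ ⌊(L ω (B i)).toReal⌋₊ =
      ∏ j, z (e j) ^ ⌊(L ω (B (e j))).toReal⌋₊ := fun ω => by
    rw [← Finset.prod_coe_sort s fun i => z i ^ ⌊(L ω (B i)).toReal⌋₊]
    exact (e.prod_comp fun i : s => z i ^ ⌊(L ω (B i)).toReal⌋₊).symm
  simp only [h2]
  rw [h1, ← Finset.sum_coe_sort s fun i => ((ν (B i)).toReal : ℂ) * (z i - 1), Complex.exp_sum,
    ← e.prod_comp fun i : s => Complex.exp (((ν (B i)).toReal : ℂ) * (z i - 1))]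
  exact Finset.prod_congr rfl fun j _ => hL.integral_pow_apply (hB _) (hν _) _

/-- Only finitely many points fall in a region of finite intensity, so in all but finitely many
parts of a partition of it there is none. -/
theorem ae_exists_finsupp (hL : IsPoissonProcess L ν Pr) [Countable ι]
    (hB : ∀ i, MeasurableSet (B i)) (hd : Pairwise fun i j => Disjoint (B i) (B j))
    (hν : ∑' i, ν (B i) ≠ ∞) :
    ∀ᵐ ω ∂Pr, ∃ n : ι →₀ ℕ, ∀ i, L ω (B i) = n i := by
  have hU : ν (⋃ i, B i) ≠ ∞ := by rwa [measure_iUnion hd hB]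
  filter_upwards [hL.ae_ne_top (.iUnion hB) hU] with ω hω
  rw [measure_iUnion hd hB] at hω
  have h1 : ∀ i, ∃ m : ℕ, L ω (B i) = m := fun i => by
    obtain ⟨m, hm⟩ := hL.integer_valued ω (B i) (hB i)
    cases m with
    | top => exact absurd (by simpa using hm) (ENNReal.ne_top_of_tsum_ne_top hω i)
    | coe m => exact ⟨m, by simpa using hm⟩
  choose m hm using h1
  have h2 : {i | m i ≠ 0}.Finite := by
    refine (ENNReal.finite_const_le_of_tsum_ne_top hω one_ne_zero).subset fun i hi => ?_
    change 1 ≤ L ω (B i)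
    rw [hm]
    exact_mod_cast Nat.one_le_iff_ne_zero.2 hi
  exact ⟨Finsupp.ofSupportFinite m h2, hm⟩

/-- Campbell's formula for a product over the points of a Poisson process. -/
theorem integral_eq_exp_of_hasProd (hL : IsPoissonProcess L ν Pr) [IsProbabilityMeasure Pr]
    [Countable ι] (hB : ∀ i, MeasurableSet (B i))
    (hd : Pairwise fun i j => Disjoint (B i) (B j)) (hν : ∀ i, ν (B i) ≠ ∞)
    (hz : ∀ i, ‖z i‖ ≤ 1) {a : ℂ} (ha : HasSum (fun i => (ν (B i)).toReal * (z i - 1)) a)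
    {F : Ω → ℂ} (hF : ∀ᵐ ω ∂Pr, HasProd (fun i => z i ^ ⌊(L ω (B i)).toReal⌋₊) (F ω)) :
    Integrable F Pr ∧ ∫ ω, F ω ∂Pr = Complex.exp a := by
  have hmeas : ∀ s : Finset ι,
      AEStronglyMeasurable (fun ω => ∏ i ∈ s, z i ^ ⌊(L ω (B i)).toReal⌋₊) Pr := fun s =>
    (Finset.measurable_prod s fun i _ => (measurable_of_countable fun n : ℕ => z i ^ n).comp
      (hL.measurable_floor_apply (hB i))).aestronglyMeasurable
  have hbound : ∀ (s : Finset ι) ω, ‖∏ i ∈ s, z i ^ ⌊(L ω (B i)).toReal⌋₊‖ ≤ 1 := fun s ω => by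
    rw [norm_prod]
    exact Finset.prod_le_one (fun _ _ => norm_nonneg _) fun i _ => by
      rw [norm_pow]; exact pow_le_one₀ (norm_nonneg _) (hz i)
  have hFm : AEStronglyMeasurable F Pr :=
    aestronglyMeasurable_of_tendsto_ae Filter.atTop hmeas hF
  refine ⟨.of_bound hFm 1 ?_, ?_⟩
  · filter_upwards [hF] with ω hω
    exact le_of_tendsto (Filter.Tendsto.norm hω) (.of_forall fun s => hbound s ω)
  · have h1 := tendsto_integral_filter_of_dominated_convergence (l := Filter.atTop)
      (fun _ => (1 : ℝ)) (.of_forall hmeas) (.of_forall fun s => ae_of_all _ (hbound s))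
      (integrable_const _) hF
    simp only [hL.integral_finset_prod_pow _ hB hd hν] at h1
    exact tendsto_nhds_unique h1 ((Complex.continuous_exp.tendsto a).comp ha)

end IsPoissonProcess

/-! ### Jump numbers of the loop ensemble -/

section JumpNumber

variable {X : Type*} [Finite X] [DecidableEq X]

/-- The total number of jumps, with the loops sorted by their vector of jump numbers `k`; the loops
without jumps, of which there may be infinitely many, do not contribute. -/
theorem totalJumps_eq_tsum (M : Measure (Loop X)) (x y : X) :
    totalJumps M x y =
      ∑' k : {k : X → X → ℕ // k ≠ 0}, (k.1 x y : ℝ≥0∞) * M (Loop.jumpVector ⁻¹' {k.1}) := by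
  calc totalJumps M x y = ∫⁻ k, (k x y : ℝ≥0∞) ∂M.map Loop.jumpVector :=
        (lintegral_map (f := fun k : X → X → ℕ => (k x y : ℝ≥0∞)) (measurable_of_countable _)
          Loop.measurable_jumpVector).symm
    _ = ∑' k : X → X → ℕ, (k x y : ℝ≥0∞) * M (Loop.jumpVector ⁻¹' {k}) := by
        rw [lintegral_countable']
        exact tsum_congr fun k => by
          rw [Measure.map_apply Loop.measurable_jumpVector (measurableSet_singleton k)]
    _ = _ := by
        refine (tsum_subtype_eq_of_support_subset
          (f := fun k : X → X → ℕ => (k x y : ℝ≥0∞) * M (Loop.jumpVector ⁻¹' {k}))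
          (s := {k | k ≠ 0}) fun k hk h0 => hk ?_).symm
        simp [h0]

variable {M : Measure (Loop X)} {n : {k : X → X → ℕ // k ≠ 0} →₀ ℕ}

theorem totalJumps_eq_natCast (hn : ∀ k, M (Loop.jumpVector ⁻¹' {k.1}) = n k) (x y : X) :
    totalJumps M x y = (n.sum fun k m => k.1 x y * m : ℕ) := by
  rw [totalJumps_eq_tsum, tsum_eq_sum (s := n.support), Finsupp.sum]
  · push_cast
    exact Finset.sum_congr rfl fun k _ => by rw [hn]
  · intro k hk
    rw [hn, Finsupp.notMem_support_iff.1 hk, Nat.cast_zero, mul_zero]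

theorem jumpNumber_eq_sum (hn : ∀ k, M (Loop.jumpVector ⁻¹' {k.1}) = n k) (x y : X) :
    jumpNumber M x y = n.sum fun k m => k.1 x y * m := by
  rw [jumpNumber, totalJumps_eq_natCast hn, ENNReal.toReal_natCast, Nat.floor_natCast]

theorem hasProd_pow_jumpNumber (hn : ∀ k, M (Loop.jumpVector ⁻¹' {k.1}) = n k)
    (Z : Matrix X X ℂ) (s : Finset (X × X)) :
    HasProd (fun k : {k : X → X → ℕ // k ≠ 0} =>
        (∏ p ∈ s, Z p.1 p.2 ^ k.1 p.1 p.2) ^ ⌊(M (Loop.jumpVector ⁻¹' {k.1})).toReal⌋₊)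
      (∏ p ∈ s, Z p.1 p.2 ^ jumpNumber M p.1 p.2) := by
  have h : ∏ p ∈ s, Z p.1 p.2 ^ jumpNumber M p.1 p.2 = ∏ k ∈ n.support,
      (∏ p ∈ s, Z p.1 p.2 ^ k.1 p.1 p.2) ^ ⌊(M (Loop.jumpVector ⁻¹' {k.1})).toReal⌋₊ := by
    simp only [jumpNumber_eq_sum hn, Finsupp.sum, ← Finset.prod_pow_eq_pow_sum, hn,
      ENNReal.toReal_natCast, Nat.floor_natCast, ← Finset.prod_pow, ← pow_mul]
    exact Finset.prod_comm
  rw [h]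
  refine hasProd_prod_of_ne_finset_one fun k hk => ?_
  rw [hn, Finsupp.notMem_support_iff.1 hk]
  simp

end JumpNumber

namespace KilledNetwork

variable {X : Type*} [Fintype X] [DecidableEq X] {𝒢 : KilledNetwork X}

theorem Transient.loopMeasure_jumpVector_eq_ofReal (h : 𝒢.Transient) {k : X → X → ℕ}
    (hk : k ≠ 0) :
    𝒢.loopMeasure (Loop.jumpVector ⁻¹' {k}) = ENNReal.ofReal
      (∑' ξ : (DiscretePointedLoop.jumps ⁻¹' {k} : Set (DiscretePointedLoop X)),
        𝒢.closedPathWeight ξ) := by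
  rw [𝒢.loopMeasure_jumpVector_preimage hk,
    ENNReal.ofReal_tsum_of_nonneg
      (f := fun ξ : (DiscretePointedLoop.jumps ⁻¹' {k} : Set (DiscretePointedLoop X)) =>
        𝒢.closedPathWeight ξ) (fun ξ => 𝒢.closedPathWeight_nonneg ξ)
      (h.summable_closedPathWeight.subtype _)]

theorem Transient.tsum_loopMeasure_ne_top (h : 𝒢.Transient) :
    ∑' k : {k : X → X → ℕ // k ≠ 0}, 𝒢.loopMeasure (Loop.jumpVector ⁻¹' {k.1}) ≠ ∞ := by
  have h1 : ∑' k : X → X → ℕ, ∑' ξ : (DiscretePointedLoop.jumps ⁻¹' {k} :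
      Set (DiscretePointedLoop X)), ENNReal.ofReal (𝒢.closedPathWeight ξ) ≠ ∞ := by
    rw [ENNReal.tsum_fiberwise (fun ξ => ENNReal.ofReal (𝒢.closedPathWeight ξ))
      DiscretePointedLoop.jumps]
    exact h.summable_closedPathWeight.tsum_ofReal_ne_top
  refine ne_top_of_le_ne_top h1 ?_
  simp only [fun k : {k : X → X → ℕ // k ≠ 0} => 𝒢.loopMeasure_jumpVector_preimage k.2]
  exact ENNReal.tsum_comp_le_tsum_of_injective Subtype.val_injective _

/-- The integral of `∏ Z^N - 1` against the loop measure is the difference of two logarithms of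
determinants. -/
theorem Transient.hasSum_loopMeasure_mul_sub_one (h : 𝒢.Transient) {Z : Matrix X X ℂ}
    (hZ : Z.IsHermitian) (hZ1 : ∀ x y, ‖Z x y‖ ≤ 1) :
    ∃ d e : ℝ, 0 < d ∧ 0 < e ∧ (1 - 𝒢.PZ Z).det = d ∧ (1 - 𝒢.PC).det = e ∧
      HasSum (fun k : {k : X → X → ℕ // k ≠ 0} =>
        ((𝒢.loopMeasure (Loop.jumpVector ⁻¹' {k.1})).toReal : ℂ) *
          (∏ p ∈ Finset.univ.offDiag, Z p.1 p.2 ^ k.1 p.1 p.2 - 1))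
        (Real.log e - Real.log d : ℂ) := by
  obtain ⟨d, hd0, hd1, hd⟩ := h.hasSum_closedPathWeight_mul hZ hZ1
  obtain ⟨e, he0, he1, he⟩ := h.hasSum_closedPathWeight_mul isHermitian_of_one (by simp)
  refine ⟨d, e, hd0, he0, hd1, by rw [← he1, PZ_one], ?_⟩
  have h1 := (hd.sub he).tsum_fiberwise DiscretePointedLoop.jumps
  rw [show (-Real.log d : ℂ) - -Real.log e = Real.log e - Real.log d by ring] at h1
  have h2 : ∀ k : X → X → ℕ, ∑' ξ : (DiscretePointedLoop.jumps ⁻¹' {k} :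
      Set (DiscretePointedLoop X)), ((𝒢.closedPathWeight ξ : ℂ) *
        ∏ i, Z (ξ.1.2 i) (ξ.1.2 (i + 1)) - (𝒢.closedPathWeight ξ : ℂ) *
        ∏ i, (Matrix.of fun _ _ : X => (1 : ℂ)) (ξ.1.2 i) (ξ.1.2 (i + 1))) =
      ((∑' ξ : (DiscretePointedLoop.jumps ⁻¹' {k} : Set (DiscretePointedLoop X)),
        𝒢.closedPathWeight ξ : ℝ) : ℂ) *
          (∏ p ∈ Finset.univ.offDiag, Z p.1 p.2 ^ k p.1 p.2 - 1) := fun k => by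
    rw [Complex.ofReal_tsum, ← tsum_mul_right]
    refine tsum_congr fun ξ => ?_
    have hξ : ξ.1.jumps = k := ξ.2
    rw [← 𝒢.closedPathWeight_mul_prod_pow_jumps Z, hξ]
    simp [mul_sub]
  simp only [h2] at h1
  refine ((hasSum_subtype_iff_of_support_subset (s := {k | k ≠ 0}) fun k hk h0 => hk ?_).2
    h1).congr_fun fun k => ?_
  · simp [h0]
  · rw [h.loopMeasure_jumpVector_eq_ofReal k.2,
      ENNReal.toReal_ofReal (tsum_nonneg
        (g := fun ξ : (DiscretePointedLoop.jumps ⁻¹' {k.1} : Set (DiscretePointedLoop X)) =>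
          𝒢.closedPathWeight ξ) fun ξ => 𝒢.closedPathWeight_nonneg ξ)]
    rfl

/-- The generating function of the jump numbers of the Poisson ensemble of loops, from Campbell's
formula for the partition of the loops according to their vector of jump numbers. -/
theorem Transient.jumpNumber_generating_function (h : 𝒢.Transient) {Z : Matrix X X ℂ}
    (hZ : Z.IsHermitian) (hZ1 : ∀ x y, ‖Z x y‖ ≤ 1) {Ω : Type*} [MeasurableSpace Ω]
    {Pr : Measure Ω} [IsProbabilityMeasure Pr] {α : ℝ} (hα : 0 < α) {L : Ω → Measure (Loop X)}
    (hL : IsPoissonProcess L (ENNReal.ofReal α • 𝒢.loopMeasure) Pr) :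
    (∀ᵐ ω ∂Pr, ∀ x y, totalJumps (L ω) x y = (jumpNumber (L ω) x y : ℝ≥0∞)) ∧
      Integrable (fun ω => ∏ p ∈ Finset.univ.offDiag, Z p.1 p.2 ^ jumpNumber (L ω) p.1 p.2) Pr ∧
      ∫ ω, ∏ p ∈ Finset.univ.offDiag, Z p.1 p.2 ^ jumpNumber (L ω) p.1 p.2 ∂Pr =
        ((1 - 𝒢.PZ Z).det / (1 - 𝒢.PC).det) ^ (-(α : ℂ)) := by
  obtain ⟨d, e, hd0, he0, hd, he, hs⟩ := h.hasSum_loopMeasure_mul_sub_one hZ hZ1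
  have hB : ∀ k : {k : X → X → ℕ // k ≠ 0},
      MeasurableSet (Loop.jumpVector ⁻¹' {k.1} : Set (Loop X)) := fun k =>
    Loop.measurable_jumpVector (measurableSet_singleton k.1)
  have hdisj : Pairwise fun k k' : {k : X → X → ℕ // k ≠ 0} =>
      Disjoint (Loop.jumpVector ⁻¹' {k.1} : Set (Loop X)) (Loop.jumpVector ⁻¹' {k'.1}) :=
    fun k k' hk => Disjoint.preimage _ (Set.disjoint_singleton.2 fun h => hk (Subtype.ext h))
  have hν : ∑' k : {k : X → X → ℕ // k ≠ 0},
      (ENNReal.ofReal α • 𝒢.loopMeasure) (Loop.jumpVector ⁻¹' {k.1}) ≠ ∞ := by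
    simp only [Measure.smul_apply, smul_eq_mul, ENNReal.tsum_mul_left]
    exact ENNReal.mul_ne_top ENNReal.ofReal_ne_top h.tsum_loopMeasure_ne_top
  have hfin := hL.ae_exists_finsupp hB hdisj hν
  refine ⟨?_, ?_⟩
  · filter_upwards [hfin] with ω ⟨n, hn⟩ x y
    rw [jumpNumber_eq_sum hn, totalJumps_eq_natCast hn]
  have hs' : HasSum (fun k : {k : X → X → ℕ // k ≠ 0} =>
      (((ENNReal.ofReal α • 𝒢.loopMeasure) (Loop.jumpVector ⁻¹' {k.1})).toReal : ℂ) *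
        (∏ p ∈ Finset.univ.offDiag, Z p.1 p.2 ^ k.1 p.1 p.2 - 1))
      (α * (Real.log e - Real.log d)) := by
    refine (hs.mul_left (α : ℂ)).congr_fun fun k => ?_
    rw [Measure.smul_apply, smul_eq_mul, ENNReal.toReal_mul, ENNReal.toReal_ofReal hα.le,
      Complex.ofReal_mul, mul_assoc]
  have hfinal := hL.integral_eq_exp_of_hasProd hB hdisj (ENNReal.ne_top_of_tsum_ne_top hν)
    (z := fun k : {k : X → X → ℕ // k ≠ 0} =>
      ∏ p ∈ Finset.univ.offDiag, Z p.1 p.2 ^ k.1 p.1 p.2)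
    (fun k => ?_) hs' (F := fun ω => ∏ p ∈ Finset.univ.offDiag,
      Z p.1 p.2 ^ jumpNumber (L ω) p.1 p.2) ?_
  · refine ⟨hfinal.1, hfinal.2.trans ?_⟩
    have hr : 0 < d / e := div_pos hd0 he0
    rw [hd, he, ← Complex.ofReal_div,
      Complex.cpow_def_of_ne_zero (Complex.ofReal_ne_zero.2 hr.ne'), ← Complex.ofReal_log hr.le,
      Real.log_div hd0.ne' he0.ne']
    push_cast
    ring_nf
  · rw [norm_prod]
    exact Finset.prod_le_one (fun _ _ => norm_nonneg _) fun p _ => by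
      rw [norm_pow]; exact pow_le_one₀ (norm_nonneg _) (hZ1 _ _)
  · filter_upwards [hfin] with ω ⟨n, hn⟩
    exact hasProd_pow_jumpNumber hn Z _

end KilledNetwork

/-! ### Exponential moments of Gaussian quadratic forms -/

namespace ProbabilityTheory

theorem integral_exp_mul_sq_gaussianReal {μ : ℝ} (hμ : μ < 1) :
    Integrable (fun x : ℝ => Real.exp (μ / 2 * x ^ 2)) (gaussianReal 0 1) ∧
      ∫ x, Real.exp (μ / 2 * x ^ 2) ∂gaussianReal 0 1 = (√(1 - μ))⁻¹ := by
  have hb : 0 < (1 - μ) / 2 := by linarith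
  have h1 : ∀ x : ℝ, gaussianPDFReal 0 1 x * Real.exp (μ / 2 * x ^ 2) =
      (√(2 * Real.pi))⁻¹ * Real.exp (-((1 - μ) / 2) * x ^ 2) := fun x => by
    rw [gaussianPDFReal, mul_assoc, ← Real.exp_add]
    simp only [NNReal.coe_one, mul_one, sub_zero]
    ring_nf
  constructor
  · rw [gaussianReal_of_var_ne_zero 0 one_ne_zero, gaussianPDF_def]
    refine (integrable_withDensity_iff_integrable_smul₀' (by fun_prop)
      (ae_of_all _ fun _ => ENNReal.ofReal_lt_top)).2 ?_
    refine ((integrable_exp_neg_mul_sq hb).const_mul (√(2 * Real.pi))⁻¹).congr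
      (ae_of_all _ fun x => ?_)
    change _ = (ENNReal.ofReal _).toReal • _
    rw [ENNReal.toReal_ofReal (gaussianPDFReal_nonneg _ _ _), smul_eq_mul, h1]
  · rw [integral_gaussianReal_eq_integral_smul one_ne_zero]
    simp only [smul_eq_mul, h1]
    rw [integral_const_mul, integral_gaussian, ← Real.sqrt_inv, ← Real.sqrt_inv,
      ← Real.sqrt_mul (by positivity)]
    congr 1
    have := Real.pi_pos
    have : 1 - μ ≠ 0 := by linarith
    field_simp

variable {Ω ι : Type*} [MeasurableSpace Ω] [Fintype ι] {Pr : Measure Ω} [IsProbabilityMeasure Pr]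

/-- Uncorrelated components of a Gaussian vector are independent, so the expectation factorizes. -/
theorem integral_exp_sum_sq_of_hasGaussianLaw {W : ι → Ω → ℝ}
    (hW : HasGaussianLaw (fun ω => (W · ω)) Pr) (h0 : ∀ i, ∫ ω, W i ω ∂Pr = 0)
    (h1 : ∀ i, covariance (W i) (W i) Pr = 1)
    (h2 : ∀ i j, i ≠ j → covariance (W i) (W j) Pr = 0) {μ : ι → ℝ} (hμ : ∀ i, μ i < 1) :
    Integrable (fun ω => Real.exp (∑ i, μ i / 2 * W i ω ^ 2)) Pr ∧
      ∫ ω, Real.exp (∑ i, μ i / 2 * W i ω ^ 2) ∂Pr = ∏ i, (√(1 - μ i))⁻¹ := by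
  have hi : ∀ i, HasGaussianLaw (W i) Pr := fun i => hW.eval i
  have hind := hW.iIndepFun_of_covariance_eq_zero h2
  have hlaw : ∀ i, Pr.map (W i) = gaussianReal 0 1 := fun i => by
    rw [(hi i).map_eq_gaussianReal, h0, ← covariance_self (hi i).aemeasurable, h1]
    simp
  have hmap : Pr.map (fun ω i => W i ω) = Measure.pi fun _ : ι => gaussianReal 0 1 := by
    rw [(iIndepFun_iff_map_fun_eq_pi_map fun i => (hi i).aemeasurable).1 hind]
    simp only [hlaw]
  have hm : Measurable fun w : ι → ℝ => ∏ i, Real.exp (μ i / 2 * w i ^ 2) := by fun_prop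
  have hae : AEMeasurable (fun ω i => W i ω) Pr := hW.aemeasurable
  simp only [Real.exp_sum]
  constructor
  · have h3 : Integrable (fun w : ι → ℝ => ∏ i, Real.exp (μ i / 2 * w i ^ 2))
        (Pr.map fun ω i => W i ω) := by
      rw [hmap]
      exact Integrable.fintype_prod (f := fun i x => Real.exp (μ i / 2 * x ^ 2))
        fun i => (integral_exp_mul_sq_gaussianReal (hμ i)).1
    exact h3.comp_aemeasurable hae
  · rw [← integral_map (φ := fun ω i => W i ω)
      (f := fun w : ι → ℝ => ∏ i, Real.exp (μ i / 2 * w i ^ 2)) hae hm.aestronglyMeasurable,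
      hmap, integral_fintype_prod_eq_prod (fun i x => Real.exp (μ i / 2 * x ^ 2))]
    exact Finset.prod_congr rfl fun i _ => (integral_exp_mul_sq_gaussianReal (hμ i)).2

end ProbabilityTheory

/-! ### The complex free field -/

theorem ProbabilityTheory.IsGaussianProcess.hasGaussianLaw_pi {Ω X : Type*} [MeasurableSpace Ω]
    [Fintype X] {Pr : Measure Ω} {φ : X → Ω → ℝ} (hφ : IsGaussianProcess φ Pr) :
    HasGaussianLaw (fun ω => (φ · ω)) Pr :=
  (hφ.hasGaussianLaw Finset.univ).map
    (.pi fun x => .proj (R := ℝ) (φ := fun _ : (Finset.univ : Finset X) => ℝ)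
      ⟨x, Finset.mem_univ x⟩)

namespace KilledNetwork

open scoped ComplexOrder

variable {X : Type*} [Fintype X] [DecidableEq X] {𝒢 : KilledNetwork X}

theorem Transient.map_green (h : 𝒢.Transient) :
    𝒢.green.map ((↑) : ℝ → ℂ) =
      (𝒢.dualityMatrix - 𝒢.twistedC (Matrix.of fun _ _ => 1))⁻¹ := by
  set H : Matrix X X ℝ := Matrix.diagonal 𝒢.dualityMeasure - Matrix.of 𝒢.C
  have hmap : Complex.ofRealHom.mapMatrix H =
      𝒢.dualityMatrix - 𝒢.twistedC (Matrix.of fun _ _ => 1) := by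
    ext x y
    simp [H, dualityMatrix, twistedC, Matrix.diagonal_apply, apply_ite Complex.ofReal]
  have hpos := h.posDef_sub_twistedC isHermitian_of_one (by simp)
  have hdet : IsUnit H.det := by
    refine isUnit_iff_ne_zero.2 fun h0 => hpos.det_pos.ne' ?_
    rw [← hmap, ← RingHom.map_det, h0, map_zero]
  refine (Matrix.inv_eq_left_inv ?_).symm
  rw [← hmap]
  change Complex.ofRealHom.mapMatrix H⁻¹ * Complex.ofRealHom.mapMatrix H = 1
  rw [← map_mul, Matrix.nonsing_inv_mul _ hdet, map_one]

section FreeField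

variable {Ω : Type*} [MeasurableSpace Ω] {Pr : Measure Ω} {φ : X → Ω → ℂ}

/-- The real linear combination `∑ₓ (a x · Re φₓ + b x · Im φₓ)`. -/
def reImComb (φ : X → Ω → ℂ) (a b : X → ℝ) (ω : Ω) : ℝ :=
  ∑ x, (a x * (φ x ω).re + b x * (φ x ω).im)

theorem IsComplexFreeField.hasGaussianLaw_reImComb (hφ : 𝒢.IsComplexFreeField φ Pr) {ι : Type*}
    [Fintype ι] (a b : ι → X → ℝ) :
    HasGaussianLaw (fun ω i => reImComb φ (a i) (b i) ω) Pr := by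
  have h := hφ.indep.hasGaussianLaw hφ.re.gaussian.hasGaussianLaw_pi
    hφ.im.gaussian.hasGaussianLaw_pi
  let T : ((X → ℝ) × (X → ℝ)) →L[ℝ] ι → ℝ := .pi fun i => ∑ x,
    (a i x • (ContinuousLinearMap.proj x ∘L .fst ℝ (X → ℝ) (X → ℝ)) +
      b i x • (ContinuousLinearMap.proj x ∘L .snd ℝ (X → ℝ) (X → ℝ)))
  have hT : (fun ω i => reImComb φ (a i) (b i) ω) =
      fun ω => T (fun x => (φ x ω).re, fun x => (φ x ω).im) := by
    ext ω i
    simp [T, reImComb]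
  rw [hT]
  exact h.map_fun T

theorem IsComplexFreeField.memLp_re (hφ : 𝒢.IsComplexFreeField φ Pr) (x : X) :
    MemLp (fun ω => (φ x ω).re) 2 Pr :=
  (hφ.re.gaussian.hasGaussianLaw_eval x).memLp_two

theorem IsComplexFreeField.memLp_im (hφ : 𝒢.IsComplexFreeField φ Pr) (x : X) :
    MemLp (fun ω => (φ x ω).im) 2 Pr :=
  (hφ.im.gaussian.hasGaussianLaw_eval x).memLp_two

variable [IsProbabilityMeasure Pr]

theorem IsComplexFreeField.integral_reImComb (hφ : 𝒢.IsComplexFreeField φ Pr) (a b : X → ℝ) :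
    ∫ ω, reImComb φ a b ω ∂Pr = 0 := by
  have h1 : ∀ x, Integrable (fun ω => a x * (φ x ω).re) Pr := fun x =>
    ((hφ.memLp_re x).integrable (by norm_num)).const_mul _
  have h2 : ∀ x, Integrable (fun ω => b x * (φ x ω).im) Pr := fun x =>
    ((hφ.memLp_im x).integrable (by norm_num)).const_mul _
  have h3 : ∀ x, Integrable (fun ω => a x * (φ x ω).re + b x * (φ x ω).im) Pr := fun x =>
    (h1 x).add (h2 x)
  unfold reImComb
  rw [integral_finsetSum _ fun x _ => h3 x]
  refine Finset.sum_eq_zero fun x _ => ?_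
  rw [integral_add (h1 x) (h2 x), integral_const_mul, integral_const_mul, hφ.re.centred,
    hφ.im.centred]
  simp

theorem IsComplexFreeField.covariance_reImComb (hφ : 𝒢.IsComplexFreeField φ Pr)
    (a b c d : X → ℝ) :
    covariance (reImComb φ a b) (reImComb φ c d) Pr =
      ∑ x, ∑ y, 𝒢.green x y * (a x * c y + b x * d y) := by
  have hre := hφ.memLp_re
  have him := hφ.memLp_im
  have hri : ∀ x y, covariance (fun ω => (φ x ω).re) (fun ω => (φ y ω).im) Pr = 0 := fun x y =>
    (hφ.indep.comp (φ := fun f : X → ℝ => f x) (ψ := fun f : X → ℝ => f y)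
      (measurable_pi_apply x) (measurable_pi_apply y)).covariance_eq_zero (hre x) (him y)
  have hir : ∀ x y, covariance (fun ω => (φ x ω).im) (fun ω => (φ y ω).re) Pr = 0 := fun x y => by
    rw [covariance_comm, hri]
  have hm : ∀ (a b : X → ℝ) x, MemLp (fun ω => a x * (φ x ω).re + b x * (φ x ω).im) 2 Pr :=
    fun a b x => ((hre x).const_mul _).add ((him x).const_mul _)
  unfold reImComb
  rw [covariance_fun_sum_fun_sum (hm a b) (hm c d)]
  refine Finset.sum_congr rfl fun x _ => Finset.sum_congr rfl fun y _ => ?_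
  have h1 := covariance_add_left (μ := Pr) ((hre x).const_mul (a x)) ((him x).const_mul (b x))
    (hm c d y)
  have h2 := fun f (hf : MemLp f 2 Pr) => covariance_add_right (μ := Pr) hf
    ((hre y).const_mul (c y)) ((him y).const_mul (d y))
  refine h1.trans ?_
  refine (congrArg₂ (· + ·) (h2 _ ((hre x).const_mul (a x)))
    (h2 _ ((him x).const_mul (b x)))).trans ?_
  simp only [covariance_const_mul_left, covariance_const_mul_right, hri, hir,
    hφ.re.covariance_eq, hφ.im.covariance_eq]
  ring

/-- If `B G B* = 1`, then the real and imaginary parts of the components of `B φ̄` are independent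
standard Gaussian variables. -/
theorem IsComplexFreeField.integral_exp_normSq (hφ : 𝒢.IsComplexFreeField φ Pr)
    {B : Matrix X X ℂ} (hB : B * 𝒢.green.map ((↑) : ℝ → ℂ) * B.conjTranspose = 1) {μ : X → ℝ}
    (hμ : ∀ i, μ i < 1) :
    Integrable (fun ω => Real.exp (∑ i, μ i / 2 *
        Complex.normSq (∑ x, B i x * star (φ x ω)))) Pr ∧
      ∫ ω, Real.exp (∑ i, μ i / 2 * Complex.normSq (∑ x, B i x * star (φ x ω))) ∂Pr =
        ∏ i, (1 - μ i)⁻¹ := by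
  have hB' : ∀ i j, ∑ x, ∑ y, (𝒢.green x y : ℂ) * (B i x * star (B j y)) =
      (1 : Matrix X X ℂ) i j := fun i j => by
    rw [← hB, Matrix.mul_apply, Finset.sum_comm]
    refine Finset.sum_congr rfl fun y _ => ?_
    rw [Matrix.mul_apply, Finset.sum_mul]
    refine Finset.sum_congr rfl fun x _ => ?_
    rw [Matrix.conjTranspose_apply, Matrix.map_apply]
    ring
  have hre : ∀ i j, ∑ x, ∑ y, 𝒢.green x y *
      ((B i x).re * (B j y).re + (B i x).im * (B j y).im) = if i = j then 1 else 0 := fun i j => by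
    have := congrArg Complex.re (hB' i j)
    rw [Matrix.one_apply, apply_ite Complex.re] at this
    simpa using this
  have him : ∀ i j, ∑ x, ∑ y, 𝒢.green x y *
      ((B i x).re * (B j y).im - (B i x).im * (B j y).re) = 0 := fun i j => by
    have := congrArg Complex.im (hB' i j)
    rw [Matrix.one_apply, apply_ite Complex.im] at this
    simp only [Complex.im_sum, Complex.mul_im, RCLike.star_def, Complex.ofReal_re,
      Complex.ofReal_im, zero_mul, add_zero,
      Complex.conj_re, Complex.conj_im, Complex.one_im, Complex.zero_im, ite_self] at this
    rw [← neg_eq_zero, ← this, ← Finset.sum_neg_distrib]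
    refine Finset.sum_congr rfl fun x _ => ?_
    rw [← Finset.sum_neg_distrib]
    exact Finset.sum_congr rfl fun y _ => by ring
  -- `Re` and `Im` of `(B φ̄)ᵢ`, indexed by `inl i` and `inr i`, as combinations of `Re φ`, `Im φ`
  let a : X ⊕ X → X → ℝ := Sum.elim (fun i x => (B i x).re) fun i x => (B i x).im
  let b : X ⊕ X → X → ℝ := Sum.elim (fun i x => (B i x).im) fun i x => -(B i x).re
  have hcov : ∀ s t, covariance (reImComb φ (a s) (b s)) (reImComb φ (a t) (b t)) Pr =
      if s = t then 1 else 0 := by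
    intro s t
    rw [hφ.covariance_reImComb]
    rcases s with i | i <;> rcases t with j | j
    · simpa [a, b] using hre i j
    · simpa [a, b, sub_eq_add_neg] using him i j
    · simp only [a, b, Sum.elim_inl, Sum.elim_inr, reduceCtorEq, if_false]
      rw [← neg_eq_zero, ← him i j, ← Finset.sum_neg_distrib]
      refine Finset.sum_congr rfl fun x _ => ?_
      rw [← Finset.sum_neg_distrib]
      exact Finset.sum_congr rfl fun y _ => by ring
    · have := hre i j
      simp only [add_comm ((B i _).re * _)] at this
      simpa [a, b] using this
  have hnorm : ∀ ω, ∑ i, μ i / 2 * Complex.normSq (∑ x, B i x * star (φ x ω)) =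
      ∑ s : X ⊕ X, Sum.elim μ μ s / 2 * reImComb φ (a s) (b s) ω ^ 2 := fun ω => by
    rw [Fintype.sum_sum_type, ← Finset.sum_add_distrib]
    refine Finset.sum_congr rfl fun i _ => ?_
    have h1 : (∑ x, B i x * star (φ x ω)).re = reImComb φ (a (.inl i)) (b (.inl i)) ω := by
      simp [reImComb, a, b]
    have h2 : (∑ x, B i x * star (φ x ω)).im = reImComb φ (a (.inr i)) (b (.inr i)) ω := by
      simp only [reImComb, a, b, Complex.im_sum, Complex.mul_im, RCLike.star_def,
        Complex.conj_re, Complex.conj_im, Sum.elim_inr]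
      exact Finset.sum_congr rfl fun x _ => by ring
    rw [Complex.normSq_apply, h1, h2, Sum.elim_inl, Sum.elim_inr]
    ring
  simp only [hnorm]
  have hmain := integral_exp_sum_sq_of_hasGaussianLaw
    (W := fun s => reImComb φ (a s) (b s)) (hφ.hasGaussianLaw_reImComb a b)
    (fun s => hφ.integral_reImComb _ _) (fun s => by rw [hcov, if_pos rfl])
    (fun s t hst => by rw [hcov, if_neg hst]) (μ := Sum.elim μ μ) (by rintro (i | i) <;> exact hμ i)
  refine ⟨hmain.1, hmain.2.trans ?_⟩
  rw [Fintype.prod_sum_type, ← Finset.prod_mul_distrib]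
  refine Finset.prod_congr rfl fun i _ => ?_
  rw [Sum.elim_inl, Sum.elim_inr, ← mul_inv, Real.mul_self_sqrt (sub_pos.2 (hμ i)).le]

/-- The exponent is half the Hermitian form `C^Z - C` evaluated at `φ̄`, which is diagonalized
simultaneously with the inverse covariance `diag(λ) - C`. -/
theorem Transient.integral_exp_freeField (h : 𝒢.Transient) {Z : Matrix X X ℂ}
    (hZ : Z.IsHermitian) (hZ1 : ∀ x y, ‖Z x y‖ ≤ 1) (hφ : 𝒢.IsComplexFreeField φ Pr) :
    Integrable (fun ω => Complex.exp (∑ p ∈ Finset.univ.offDiag,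
        (1 / 2 : ℂ) * 𝒢.C p.1 p.2 * (Z p.1 p.2 - 1) * φ p.1 ω * star (φ p.2 ω))) Pr ∧
      ∫ ω, Complex.exp (∑ p ∈ Finset.univ.offDiag,
        (1 / 2 : ℂ) * 𝒢.C p.1 p.2 * (Z p.1 p.2 - 1) * φ p.1 ω * star (φ p.2 ω)) ∂Pr =
        ((1 - 𝒢.PZ Z).det / (1 - 𝒢.PC).det)⁻¹ := by
  set C₁ := 𝒢.twistedC (Matrix.of fun _ _ => 1)
  set H := 𝒢.dualityMatrix - C₁
  set Q := 𝒢.twistedC Z - C₁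
  have hHQ : H - Q = 𝒢.dualityMatrix - 𝒢.twistedC Z := sub_sub_sub_cancel_right _ _ _
  have hH : H.PosDef := h.posDef_sub_twistedC isHermitian_of_one (by simp)
  have hHd : IsUnit H.det := (Matrix.isUnit_iff_isUnit_det _).1 hH.isUnit
  have hQ : Q.IsHermitian :=
    (𝒢.isHermitian_twistedC hZ).sub (𝒢.isHermitian_twistedC isHermitian_of_one)
  obtain ⟨A, μ, h1, h2⟩ := hH.exists_simultaneous_diagonal hQ
  have hμ := Matrix.lt_one_of_posDef_sub h1 h2 (hHQ ▸ h.posDef_sub_twistedC hZ hZ1)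
  set B := A.conjTranspose * H
  have hAB : A * B = 1 := mul_eq_one_comm.1 h1
  have hB : B * 𝒢.green.map ((↑) : ℝ → ℂ) * B.conjTranspose = 1 := by
    rw [h.map_green, Matrix.conjTranspose_mul, hH.isHermitian.eq,
      Matrix.conjTranspose_conjTranspose, Matrix.mul_nonsing_inv_cancel_right _ _ hHd,
      ← Matrix.mul_assoc, h1]
  have hexp : ∀ ω, ∑ p ∈ Finset.univ.offDiag,
      (1 / 2 : ℂ) * 𝒢.C p.1 p.2 * (Z p.1 p.2 - 1) * φ p.1 ω * star (φ p.2 ω) =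
      ((∑ i, μ i / 2 * Complex.normSq (∑ x, B i x * star (φ x ω)) : ℝ) : ℂ) := fun ω => by
    set v : X → ℂ := fun x => star (φ x ω)
    have hv : A.mulVec (B.mulVec v) = v := by rw [Matrix.mulVec_mulVec, hAB, Matrix.one_mulVec]
    calc ∑ p ∈ Finset.univ.offDiag,
          (1 / 2 : ℂ) * 𝒢.C p.1 p.2 * (Z p.1 p.2 - 1) * φ p.1 ω * star (φ p.2 ω)
        = ∑ p : X × X, (1 / 2 : ℂ) * (star (v p.1) * (Q p.1 p.2 * v p.2)) := by
          rw [← Finset.sum_subset (Finset.subset_univ Finset.univ.offDiag)]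
          · refine Finset.sum_congr rfl fun p _ => ?_
            simp only [Q, C₁, v, twistedC, Matrix.sub_apply, Matrix.of_apply, star_star]
            ring
          · intro p _ hp
            have hp' : p.1 = p.2 := by simpa using hp
            simp [Q, C₁, twistedC, hp', 𝒢.C_self]
      _ = (1 / 2 : ℂ) * (star v ⬝ᵥ Q.mulVec v) := by
          rw [← Finset.mul_sum, Fintype.sum_prod_type]
          simp only [dotProduct, Matrix.mulVec, Finset.mul_sum, Pi.star_apply]
      _ = (1 / 2 : ℂ) * (star (B.mulVec v) ⬝ᵥ
            (A.conjTranspose * Q * A).mulVec (B.mulVec v)) := by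
          nth_rw 1 2 [← hv]
          rw [Matrix.star_mulVec, ← Matrix.dotProduct_mulVec, Matrix.mulVec_mulVec,
            Matrix.mulVec_mulVec, Matrix.mul_assoc]
      _ = _ := by
          rw [h2]
          simp only [dotProduct, Matrix.mulVec_diagonal, Pi.star_apply, Finset.mul_sum]
          push_cast
          refine Finset.sum_congr rfl fun i _ => ?_
          have h3 : (Complex.normSq (∑ x, B i x * star (φ x ω)) : ℂ) =
              star (B.mulVec v i) * B.mulVec v i := Complex.normSq_eq_conj_mul_self
          rw [h3]
          ring
  have hmain := hφ.integral_exp_normSq hB hμ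
  simp only [hexp, ← Complex.ofReal_exp]
  refine ⟨hmain.1.ofReal, ?_⟩
  rw [integral_complex_ofReal, hmain.2, ← 𝒢.PZ_one, h.det_one_sub_PZ, h.det_one_sub_PZ,
    mul_div_mul_left _ _ (inv_ne_zero h.posDef_dualityMatrix.det_pos.ne'), ← hHQ,
    Matrix.det_sub_eq_of_simultaneous_diagonal h1 h2, mul_div_cancel_left₀ _ hHd.ne_zero,
    ← Complex.ofReal_inv, Finset.prod_inv_distrib]

end FreeField

end KilledNetwork

/-! ### Generating function of the jump numbers and its Gaussian representation -/

theorem mainTheorem3 {X : Type*} [Fintype X] [DecidableEq X]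
    (𝒢 : KilledNetwork X) (h𝒢 : 𝒢.Transient)
    (Z : Matrix X X ℂ) (hZ : Z.IsHermitian) (hZ1 : ∀ x y, 0 < ‖Z x y‖ ∧ ‖Z x y‖ ≤ 1)
    {Ω Ω' : Type*} [MeasurableSpace Ω] [MeasurableSpace Ω']
    (Pr : Measure Ω) [IsProbabilityMeasure Pr] (Pr' : Measure Ω') [IsProbabilityMeasure Pr'] :
    -- the base of the power below is a positive real number
    (∃ r : ℝ, 0 < r ∧ (1 - 𝒢.PZ Z).det / (1 - 𝒢.PC).det = (r : ℂ)) ∧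
    -- i)
    (∀ (α : ℝ) (L : Ω → Measure (Loop X)), 0 < α →
      IsPoissonProcess L (ENNReal.ofReal α • 𝒢.loopMeasure) Pr →
      (∀ᵐ ω ∂Pr, ∀ x y, totalJumps (L ω) x y = (jumpNumber (L ω) x y : ℝ≥0∞)) ∧
      Integrable (fun ω => ∏ p ∈ Finset.univ.offDiag, Z p.1 p.2 ^ jumpNumber (L ω) p.1 p.2) Pr ∧
      ∫ ω, ∏ p ∈ Finset.univ.offDiag, Z p.1 p.2 ^ jumpNumber (L ω) p.1 p.2 ∂Pr =
        ((1 - 𝒢.PZ Z).det / (1 - 𝒢.PC).det) ^ (-(α : ℂ))) ∧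
    -- ii)
    (∀ (L : Ω → Measure (Loop X)) (φ : X → Ω' → ℂ),
      IsPoissonProcess L 𝒢.loopMeasure Pr → 𝒢.IsComplexFreeField φ Pr' →
      Integrable (fun ω => Complex.exp (∑ p ∈ Finset.univ.offDiag,
        (1 / 2 : ℂ) * 𝒢.C p.1 p.2 * (Z p.1 p.2 - 1) * φ p.1 ω * star (φ p.2 ω))) Pr' ∧
      ∫ ω, ∏ p ∈ Finset.univ.offDiag, Z p.1 p.2 ^ jumpNumber (L ω) p.1 p.2 ∂Pr =
        ∫ ω, Complex.exp (∑ p ∈ Finset.univ.offDiag,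
          (1 / 2 : ℂ) * 𝒢.C p.1 p.2 * (Z p.1 p.2 - 1) * φ p.1 ω * star (φ p.2 ω)) ∂Pr') := by

  have hZ2 : ∀ x y, ‖Z x y‖ ≤ 1 := fun x y => (hZ1 x y).2
  refine ⟨?_, fun α L hα hL => h𝒢.jumpNumber_generating_function hZ hZ2 hα hL,
    fun L φ hL hφ => ?_⟩
  · obtain ⟨d, e, hd0, he0, hd, he, -⟩ := h𝒢.hasSum_loopMeasure_mul_sub_one hZ hZ2
    exact ⟨d / e, div_pos hd0 he0, by rw [hd, he, Complex.ofReal_div]⟩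
  · have hint := h𝒢.integral_exp_freeField hZ hZ2 hφ
    refine ⟨hint.1, ?_⟩
    have hL' : IsPoissonProcess L (ENNReal.ofReal 1 • 𝒢.loopMeasure) Pr := by
      rwa [ENNReal.ofReal_one, one_smul]
    rw [(h𝒢.jumpNumber_generating_function hZ hZ2 one_pos hL').2.2, hint.2, Complex.ofReal_one,
      Complex.cpow_neg_one]
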